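/- Let $K\in\mathbb R$. There is a constant $c>0$, depending only on $K$, and for every integer $n\ge 2$ and all real $F_0,F_1$ there are constants $A,B,C$ with $C>0$, depending only on $n,F_0,F_1$ and $K$, such that the following holds. Let $(M,g)$ be a compact Kähler manifold of complex dimension $n$, with smooth metric $g=(g_{j\bar k})$ and Kähler form $\omega=i\sum g_{j\bar k}\,dz^j\wedge d\bar z^k$, and suppose that the absolute value of the holomorphic bisectional curvature of $g$ has supremum at most $K$ over $M$. Let $f:M\to\mathbb R$ be of class $C^3$, and let $\varphi:M\to\mathbb R$ be of class $C^5$ and admissible, that is, $\tilde g_{j\bar k}=g_{j\bar k}+\partial_j\partial_{\bar k}\varphi$ is positive definite at every point. Write $\Delta u=-g^{j\bar k}\partial_j\partial_{\bar k}u$ and $\tilde\Delta u=-\tilde g^{j\bar k}\partial_j\partial_{\bar k}u$ for the complex Laplacians of $g$ and $\tilde g$. Assume that $\varphi$ solves the Calabi–Yau equation $$\frac{(\omega+i\partial\bar\partial\varphi)^n}{\omega^n}=\frac{\det\tilde g}{\det g}=e^f ,$$ and that $f\le F_0$ and $\Delta f\le F_1$ on $M$. Then, at every point of $M$, $$(n-\Delta\varphi)\,\tilde\Delta\bigl(\log(n-\Delta\varphi)-c\varphi\bigr)\le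 A+B\,(n-\Delta\varphi)-C\,(n-\Delta\varphi)^{\frac{n}{n-1}} .$$ -/

import Mathlib

open scoped Manifold ContDiff ComplexOrder

noncomputable section

/-! ### Wirtinger calculus on `ℂⁿ` -/

/-- `∂F/∂zʲ = ½ (∂F/∂xʲ - i ∂F/∂yʲ)`. -/
def dz {n : ℕ} (j : Fin n) (F : (Fin n → ℂ) → ℂ) (z : Fin n → ℂ) : ℂ :=
  (1 / 2 : ℂ) * (fderiv ℝ F z (Pi.single j 1) - Complex.I * fderiv ℝ F z (Pi.single j Complex.I))

/-- `∂F/∂z̄ʲ = ½ (∂F/∂xʲ + i ∂F/∂yʲ)`. -/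
def dzbar {n : ℕ} (j : Fin n) (F : (Fin n → ℂ) → ℂ) (z : Fin n → ℂ) : ℂ :=
  (1 / 2 : ℂ) * (fderiv ℝ F z (Pi.single j 1) + Complex.I * fderiv ℝ F z (Pi.single j Complex.I))

/-! ### Kähler metrics on a complex manifold of dimension `n` -/

/-- A field of sesquilinear forms (linear in the first, conjugate linear in the second variable) on
the holomorphic tangent spaces `T_pM` of `M`, which are identified with `T_p^{1,0}M` as usual:
`h p Z W` stands for `g_ℂ(Z, W̄)`. -/
abbrev SesqField (n : ℕ) (M : Type*) [TopologicalSpace M] [ChartedSpace (Fin n → ℂ) M] :=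
  ∀ p : M, TangentSpace 𝓘(ℂ, Fin n → ℂ) p →ₗ[ℂ] TangentSpace 𝓘(ℂ, Fin n → ℂ) p →ₗ⋆[ℂ] ℂ

/-- The pull-back of `h` by the inverse of the chart `e`, a field of sesquilinear forms on
`e.target ⊆ ℂⁿ`. -/
def SesqField.inChart {n : ℕ} {M : Type*} [TopologicalSpace M] [ChartedSpace (Fin n → ℂ) M]
    (h : SesqField n M) (e : OpenPartialHomeomorph M (Fin n → ℂ)) (z u v : Fin n → ℂ) : ℂ :=
  h (e.symm z)
    (mfderiv 𝓘(ℂ, Fin n → ℂ) 𝓘(ℂ, Fin n → ℂ) e.symm z u)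
    (mfderiv 𝓘(ℂ, Fin n → ℂ) 𝓘(ℂ, Fin n → ℂ) e.symm z v)

/-- The associated real two-form `ω = i ∑ g_{jk̄} dzʲ ∧ dz̄ᵏ` in the chart `e`, evaluated at the
vectors `u`, `v`: for a Hermitian form, `ω(u, v) = i (h(u, v) - h(v, u)) = -2 Im h(u, v)`. -/
def SesqField.form {n : ℕ} {M : Type*} [TopologicalSpace M] [ChartedSpace (Fin n → ℂ) M]
    (h : SesqField n M) (e : OpenPartialHomeomorph M (Fin n → ℂ)) (z u v : Fin n → ℂ) : ℝ :=
  -2 * (h.inChart e z u v).im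

/-- A smooth Kähler metric on the complex `n`-dimensional manifold `M`: a Hermitian, positive
definite, smooth field of sesquilinear forms on the tangent spaces whose two-form `ω` is closed. -/
structure KahlerMetric (n : ℕ) (M : Type*) [TopologicalSpace M] [ChartedSpace (Fin n → ℂ) M] where
  /-- the value of the metric at a point -/
  toForm : SesqField n M
  hermitian : ∀ (p : M) (u v : TangentSpace 𝓘(ℂ, Fin n → ℂ) p),
    toForm p v u = (starRingEnd ℂ) (toForm p u v)
  pos : ∀ (p : M) (u : TangentSpace 𝓘(ℂ, Fin n → ℂ) p), u ≠ 0 → 0 < (toForm p u u).re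
  smooth : ∀ e ∈ atlas (Fin n → ℂ) M, ∀ u v : Fin n → ℂ,
    ContDiffOn ℝ ∞ (fun z => toForm.inChart e z u v) e.target
  /-- `dω = 0`, where `dω(u, v, w) = D_u ω(v, w) + D_v ω(w, u) + D_w ω(u, v)` for constant vector
  fields `u`, `v`, `w` in a chart. -/
  closed : ∀ e ∈ atlas (Fin n → ℂ) M, ∀ z ∈ e.target, ∀ u v w : Fin n → ℂ,
    fderiv ℝ (fun x => toForm.form e x v w) z u + fderiv ℝ (fun x => toForm.form e x w u) z v
      + fderiv ℝ (fun x => toForm.form e x u v) z w = 0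

/-- `(∂²u/∂zʲ∂z̄ᵏ)_{j,k}` at the point `p`, in the preferred chart at `p`. -/
def complexHessian {n : ℕ} {M : Type*} [TopologicalSpace M] [ChartedSpace (Fin n → ℂ) M]
    (u : M → ℝ) (p : M) : Matrix (Fin n) (Fin n) ℂ :=
  Matrix.of fun j k =>
    dz j (dzbar k fun z => (u ((chartAt (Fin n → ℂ) p).symm z) : ℂ)) (chartAt (Fin n → ℂ) p p)

/-- The complex Laplacian, with the sign for which it is a nonnegative operator,
`-∑ G^{jk̄} ∂²u/∂zʲ∂z̄ᵏ`, of a metric whose components at each point `p`, in the preferred chart at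
`p`, are `G p = (G_{jk̄})`. Here `∑ₖ G^{jk̄} G_{lk̄} = δʲₗ`, that is, `G^{jk̄} = (G⁻¹)ₖⱼ`.
(It is a scalar, so it does not depend on the chart; it is real because `G` and the complex
Hessian are Hermitian.) -/
def complexLaplacian {n : ℕ} {M : Type*} [TopologicalSpace M] [ChartedSpace (Fin n → ℂ) M]
    (G : M → Matrix (Fin n) (Fin n) ℂ) (u : M → ℝ) (p : M) : ℝ :=
  -(∑ j, ∑ k, (G p)⁻¹ k j * complexHessian u p j k).re

namespace KahlerMetric

variable {n : ℕ} {M : Type*} [TopologicalSpace M] [ChartedSpace (Fin n → ℂ) M]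

/-- The components `g_{jk̄}` of the metric in the chart `e`. -/
def coeff (g : KahlerMetric n M) (e : OpenPartialHomeomorph M (Fin n → ℂ)) (z : Fin n → ℂ) :
    Matrix (Fin n) (Fin n) ℂ :=
  Matrix.of fun j k => g.toForm.inChart e z (Pi.single j 1) (Pi.single k 1)

/-- The components `g_{jk̄}` at `p` in the preferred chart at `p`. -/
def coeffAt (g : KahlerMetric n M) (p : M) : Matrix (Fin n) (Fin n) ℂ :=
  g.coeff (chartAt (Fin n → ℂ) p) (chartAt (Fin n → ℂ) p p)

/-- The components `g̃_{jk̄} = g_{jk̄} + ∂²φ/∂zʲ∂z̄ᵏ` at `p` of the tensor with two-form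
`ω + i∂∂̄φ`. -/
def deformedAt (g : KahlerMetric n M) (φ : M → ℝ) (p : M) : Matrix (Fin n) (Fin n) ℂ :=
  g.coeffAt p + complexHessian φ p

/-- `φ` is admissible if `g̃ = g + ∂∂̄φ` is positive definite at every point. -/
def Admissible (g : KahlerMetric n M) (φ : M → ℝ) : Prop :=
  ∀ p, (g.deformedAt φ p).PosDef

/-- `YC(φ) = det g̃ / det g`, that is, `(ω + i∂∂̄φ)ⁿ / ωⁿ`. -/
def YC (g : KahlerMetric n M) (φ : M → ℝ) (p : M) : ℂ :=
  (g.deformedAt φ p).det / (g.coeffAt p).det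

/-- The Laplacian `Δ` of `g`. -/
def laplacian (g : KahlerMetric n M) (u : M → ℝ) : M → ℝ :=
  complexLaplacian g.coeffAt u

/-- The Laplacian `Δ̃` of `g̃ = g + ∂∂̄φ`. -/
def deformedLaplacian (g : KahlerMetric n M) (φ u : M → ℝ) : M → ℝ :=
  complexLaplacian (g.deformedAt φ) u

/-- The curvature components
`R_{ij̄kl̄} = -∂ₖ∂_{l̄} g_{ij̄} + ∑ g^{rs̄} ∂ₖ g_{is̄} ∂_{l̄} g_{rj̄}`
at `p` in the preferred chart at `p`. -/
def curvature (g : KahlerMetric n M) (p : M) (i j k l : Fin n) : ℂ :=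
  let e := chartAt (Fin n → ℂ) p
  let z := e p
  (∑ r, ∑ s, (g.coeff e z)⁻¹ s r * dz k (fun x => g.coeff e x i s) z
      * dzbar l (fun x => g.coeff e x r j) z)
    - dz k (dzbar l fun x => g.coeff e x i j) z

/-- `|Z|² = g(Z, Z̄)` for the vector with components `Z` in the preferred chart at `p`. -/
def normSq (g : KahlerMetric n M) (p : M) (Z : Fin n → ℂ) : ℝ :=
  (∑ j, ∑ k, g.coeffAt p j k * Z j * (starRingEnd ℂ) (Z k)).re

/-- The holomorphic bisectional curvature `R(Z, Z̄, W, W̄) / (|Z|² |W|²)`. -/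
def bisectional (g : KahlerMetric n M) (p : M) (Z W : Fin n → ℂ) : ℝ :=
  (∑ i, ∑ j, ∑ k, ∑ l, g.curvature p i j k l * Z i * (starRingEnd ℂ) (Z j) * W k
      * (starRingEnd ℂ) (W l)).re / (g.normSq p Z * g.normSq p W)

/-- The supremum over `M` of the absolute value of the holomorphic bisectional curvature. (It is
finite when `M` is compact.) -/
def bisectionalSup (g : KahlerMetric n M) : ℝ :=
  sSup {r : ℝ | ∃ (p : M) (Z W : Fin n → ℂ), Z ≠ 0 ∧ W ≠ 0 ∧ r = |g.bisectional p Z W|}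

end KahlerMetric

end

/-!
The estimate is Yau's second order computation, arranged so that it needs no normal coordinates and
that the constant `c` does not depend on the dimension.

Write `G` for the matrix of `g` in a chart, `H = G + ∂∂̄φ` for that of `g̃`, and
`y = tr (G⁻¹ H) = n - Δφ`. Let `R = ∂ₖG G⁻¹ ∂_{l̄}G - ∂ₖ∂_{l̄}G` be the curvature of `G`, `R̃` that
of `H`, and `Xₖ = ∂ₖH - ∂ₖG G⁻¹ H` the covariant derivative of `H`. Pure matrix algebra
(`wirt_wirt_trace_eq_curvature`) gives
`∂ₖ∂_{l̄} y = tr (G⁻¹ R G⁻¹ H) + tr (G⁻¹ Xₖ H⁻¹ Xₗᴴ) - tr (G⁻¹ R̃)`. By the Kähler symmetry of `R̃`,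
the contraction of `tr (G⁻¹ R̃)` with `H⁻¹` is the contraction with `G⁻¹` of the Ricci form of `H`,
and the Ricci forms of `G` and `H` differ by `∂∂̄f` because `det H = eᶠ det G`
(`IsKahlerOn.sum_inv_mul_wirt_wirt_trace`).

Diagonalize `G` and `H` simultaneously, with eigenvalues `λᵢ` of `H` relative to `G`, and put
`S = ∑ 1/λᵢ`. In the Laplacian of `log y` the term `-|∂y|²/y` is absorbed by the terms in `X`
(`gradient_inequality`), by the Cauchy–Schwarz inequality. The curvature terms are
`∑ R_{iījj̄} (λᵢ/λⱼ - 1)`; symmetrized, the weights `λᵢ/λⱼ + λⱼ/λᵢ - 2` are nonnegative, so that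
these terms are at least `-K (y S - n²)` (`curvature_inequality`). Since the `g̃`-Laplacian of `φ`
is, up to sign, `n - S`, the choice `c = |K| + 1` leaves `- y S` on the right-hand side, and
`S ^ (n - 1) ≥ y / ∏ λᵢ = y e⁻ᶠ` (`rpow_le_sum_mul_sum_inv`) turns this into the power of `y`. The
result is `laplacian_log_trace_le`, on an open subset of `ℂⁿ`.

Two global points remain. The Laplacian `Δφ`, which is differentiated twice, is defined at each
point in the preferred chart of that point, so its invariance under holomorphic changes of
coordinates is needed to express it in one chart (`KahlerMetric.sub_laplacian_eq_trace`). And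
the supremum of the bisectional curvature bounds it only because the set of its values is bounded;
this follows from compactness and from the invariance of the curvature
(`KahlerMetric.bddAbove_bisectional`).
-/

noncomputable section

open Complex Topology Matrix

variable {n : ℕ}

/-! ### Wirtinger calculus -/

/-- The first order operator `½ (∂/∂xʲ + s i ∂/∂yʲ)`: it is `∂/∂zʲ` for `s = -1` and `∂/∂z̄ʲ` for
`s = 1`. Treating `s` as a parameter proves each rule for both operators at once. -/
def wirt (s : ℂ) (j : Fin n) (F : (Fin n → ℂ) → ℂ) (z : Fin n → ℂ) : ℂ :=
  (1 / 2 : ℂ) * (fderiv ℝ F z (Pi.single j 1) + s * (I * fderiv ℝ F z (Pi.single j I)))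

theorem dz_eq_wirt : (dz : Fin n → ((Fin n → ℂ) → ℂ) → (Fin n → ℂ) → ℂ) = wirt (-1) := by
  funext j F z; simp [dz, wirt, sub_eq_add_neg]

theorem dzbar_eq_wirt : (dzbar : Fin n → ((Fin n → ℂ) → ℂ) → (Fin n → ℂ) → ℂ) = wirt 1 := by
  funext j F z; simp [dzbar, wirt]

section rules

variable {s t : ℂ} {j k : Fin n} {F H : (Fin n → ℂ) → ℂ} {z : Fin n → ℂ}

theorem wirt_congr (h : F =ᶠ[𝓝 z] H) : wirt s j F z = wirt s j H z := by
  simp only [wirt, h.fderiv_eq]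

theorem wirt_congr_of_eqOn {U : Set (Fin n → ℂ)} (hU : IsOpen U) (hz : z ∈ U)
    (h : Set.EqOn F H U) : wirt s j F z = wirt s j H z :=
  wirt_congr (Filter.eventuallyEq_of_mem (hU.mem_nhds hz) h)

theorem wirt_const (c : ℂ) : wirt s j (fun _ => c) z = 0 := by
  simp [wirt]

theorem wirt_add (hF : DifferentiableAt ℝ F z) (hH : DifferentiableAt ℝ H z) :
    wirt s j (fun x => F x + H x) z = wirt s j F z + wirt s j H z := by
  simp only [wirt, fderiv_fun_add hF hH, _root_.add_apply]; ring

theorem wirt_neg : wirt s j (fun x => -F x) z = -wirt s j F z := by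
  simp only [wirt, fderiv_fun_neg, _root_.neg_apply]; ring

theorem wirt_sub (hF : DifferentiableAt ℝ F z) (hH : DifferentiableAt ℝ H z) :
    wirt s j (fun x => F x - H x) z = wirt s j F z - wirt s j H z := by
  simp only [wirt, fderiv_fun_sub hF hH, _root_.sub_apply]; ring

theorem wirt_mul (hF : DifferentiableAt ℝ F z) (hH : DifferentiableAt ℝ H z) :
    wirt s j (fun x => F x * H x) z = wirt s j F z * H z + F z * wirt s j H z := by
  simp only [wirt, fderiv_fun_mul hF hH, _root_.add_apply,
    _root_.smul_apply, smul_eq_mul]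
  ring

theorem wirt_sum {ι : Type*} (S : Finset ι) {F : ι → (Fin n → ℂ) → ℂ}
    (hF : ∀ i ∈ S, DifferentiableAt ℝ (F i) z) :
    wirt s j (fun x => ∑ i ∈ S, F i x) z = ∑ i ∈ S, wirt s j (F i) z := by
  simp only [wirt, fderiv_fun_sum hF, _root_.sum_apply, Finset.mul_sum,
    ← Finset.sum_add_distrib]

theorem wirt_prod {ι : Type*} [DecidableEq ι] (S : Finset ι) {F : ι → (Fin n → ℂ) → ℂ}
    (hF : ∀ i ∈ S, DifferentiableAt ℝ (F i) z) :
    wirt s j (fun x => ∏ i ∈ S, F i x) z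
      = ∑ i ∈ S, (∏ m ∈ S.erase i, F m z) * wirt s j (F i) z := by
  have h := (HasFDerivAt.finsetProd (u := S) (g := F) (fun i hi => (hF i hi).hasFDerivAt)).fderiv
  have h' : fderiv ℝ (fun x => ∏ i ∈ S, F i x) z
      = ∑ i ∈ S, (∏ m ∈ S.erase i, F m z) • fderiv ℝ (F i) z := by
    rw [← h]
  simp only [wirt, h', _root_.sum_apply, _root_.smul_apply, smul_eq_mul,
    Finset.mul_sum, ← Finset.sum_add_distrib]
  exact Finset.sum_congr rfl fun i _ => by ring

theorem wirt_conj :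
    wirt s j (fun x => (starRingEnd ℂ) (F x)) z
      = (starRingEnd ℂ) (wirt (-(starRingEnd ℂ) s) j F z) := by
  have h : fderiv ℝ (fun x => (starRingEnd ℂ) (F x)) z
      = (conjCLE : ℂ →L[ℝ] ℂ).comp (fderiv ℝ F z) :=
    conjCLE.comp_fderiv (f := F)
  simp [wirt, h, Complex.conj_ofNat]

theorem ContDiffAt.wirt {m m' : ℕ∞ω} (hF : ContDiffAt ℝ m' F z) (h : m + 1 ≤ m') :
    ContDiffAt ℝ m (wirt s j F) z := by
  have h1 := hF.fderiv_right h
  unfold _root_.wirt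
  exact contDiffAt_const.mul ((h1.clm_apply contDiffAt_const).add
    (contDiffAt_const.mul (contDiffAt_const.mul (h1.clm_apply contDiffAt_const))))

theorem wirt_comm (hF : ContDiffAt ℝ 2 F z) :
    wirt s j (wirt t k F) z = wirt t k (wirt s j F) z := by
  have hsymm : IsSymmSndFDerivAt ℝ F z := hF.isSymmSndFDerivAt (by simp)
  have hd : DifferentiableAt ℝ (fderiv ℝ F) z :=
    (hF.fderiv_right (m := 1) (by norm_num)).differentiableAt (by norm_num)
  have key : ∀ (s t : ℂ) (j k : Fin n), wirt s j (wirt t k F) z = (1 / 4 : ℂ) *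
      (fderiv ℝ (fderiv ℝ F) z (Pi.single j 1) (Pi.single k 1)
        + t * I * fderiv ℝ (fderiv ℝ F) z (Pi.single j 1) (Pi.single k I)
        + s * I * fderiv ℝ (fderiv ℝ F) z (Pi.single j I) (Pi.single k 1)
        + s * t * I * I * fderiv ℝ (fderiv ℝ F) z (Pi.single j I) (Pi.single k I)) := by
    intro s t j k
    have hv : ∀ v, DifferentiableAt ℝ (fun x => fderiv ℝ F x v) z := fun v =>
      hd.clm_apply (differentiableAt_const v)
    have hv' : ∀ u v, fderiv ℝ (fun x => fderiv ℝ F x v) z u = fderiv ℝ (fderiv ℝ F) z u v := by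
      intro u v
      rw [fderiv_clm_apply hd (differentiableAt_const v)]
      simp
    have e : fderiv ℝ (wirt t k F) z = (1 / 2 : ℂ) •
        (fderiv ℝ (fun x => fderiv ℝ F x (Pi.single k 1)) z
          + t • I • fderiv ℝ (fun x => fderiv ℝ F x (Pi.single k I)) z) := by
      unfold wirt
      rw [fderiv_const_mul, fderiv_fun_add, fderiv_const_mul, fderiv_const_mul]
      all_goals first
        | exact hv _
        | exact (hv _).const_mul _
        | exact ((hv _).const_mul _).const_mul _
        | exact (hv _).add (((hv _).const_mul _).const_mul _)
    simp only [wirt] at e ⊢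
    rw [e]
    simp only [_root_.smul_apply, _root_.add_apply, smul_eq_mul, hv']
    ring
  rw [key, key, hsymm (Pi.single j 1) (Pi.single k 1), hsymm (Pi.single j 1) (Pi.single k I),
    hsymm (Pi.single j I) (Pi.single k 1), hsymm (Pi.single j I) (Pi.single k I)]
  ring

end rules

/-- A real linear form on `ℂⁿ` in terms of its Wirtinger components. -/
theorem fderiv_apply_eq_sum (F : (Fin n → ℂ) → ℂ) (z u : Fin n → ℂ) :
    fderiv ℝ F z u = ∑ a, (u a * dz a F z + (starRingEnd ℂ) (u a) * dzbar a F z) := by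
  have hu : u = ∑ a, ((u a).re • (Pi.single a 1 : Fin n → ℂ)
      + (u a).im • (Pi.single a I : Fin n → ℂ)) := by
    funext b
    simp [Finset.sum_apply, Pi.single_apply, Finset.sum_add_distrib]
  conv_lhs => rw [hu]
  simp only [map_sum, map_add, map_smul]
  refine Finset.sum_congr rfl fun a _ => ?_
  have e1 : (u a) = (u a).re + (u a).im * I := (re_add_im _).symm
  have e2 : (starRingEnd ℂ) (u a) = (u a).re - (u a).im * I := by
    apply Complex.ext <;> simp
  rw [e2]
  generalize (u a).re = p at e1 ⊢
  generalize (u a).im = q at e1 ⊢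
  rw [e1]
  simp only [dz, dzbar, real_smul]
  linear_combination (q * fderiv ℝ F z (Pi.single a I)) * I_sq

section chain

variable {F : (Fin n → ℂ) → ℂ} {τ : (Fin n → ℂ) → (Fin n → ℂ)} {z : Fin n → ℂ}

theorem fderiv_comp_holomorphic (hF : DifferentiableAt ℝ F (τ z)) (hτ : DifferentiableAt ℂ τ z)
    (u : Fin n → ℂ) :
    fderiv ℝ (fun x => F (τ x)) z u = fderiv ℝ F (τ z) (fderiv ℂ τ z u) := by
  have h := fderiv_comp z hF (hτ.restrictScalars ℝ)
  rw [show (fun x => F (τ x)) = F ∘ τ from rfl, h, hτ.fderiv_restrictScalars ℝ]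
  rfl

theorem single_I (j : Fin n) : (Pi.single j I : Fin n → ℂ) = I • Pi.single j 1 := by
  rw [← Pi.single_smul]; simp

theorem dz_comp_holomorphic (hF : DifferentiableAt ℝ F (τ z)) (hτ : DifferentiableAt ℂ τ z)
    (j : Fin n) :
    dz j (fun x => F (τ x)) z = ∑ a, fderiv ℂ τ z (Pi.single j 1) a * dz a F (τ z) := by
  rw [dz, fderiv_comp_holomorphic hF hτ, fderiv_comp_holomorphic hF hτ, single_I, map_smul,
    fderiv_apply_eq_sum, fderiv_apply_eq_sum, Finset.mul_sum, ← Finset.sum_sub_distrib,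
    Finset.mul_sum]
  refine Finset.sum_congr rfl fun a _ => ?_
  simp only [Pi.smul_apply, smul_eq_mul, map_mul, conj_I]
  linear_combination (-(1 / 2 : ℂ) * fderiv ℂ τ z (Pi.single j 1) a * dz a F (τ z)
    + (1 / 2 : ℂ) * (starRingEnd ℂ) (fderiv ℂ τ z (Pi.single j 1) a) * dzbar a F (τ z)) * I_sq

theorem dzbar_comp_holomorphic (hF : DifferentiableAt ℝ F (τ z)) (hτ : DifferentiableAt ℂ τ z)
    (j : Fin n) :
    dzbar j (fun x => F (τ x)) z
      = ∑ a, (starRingEnd ℂ) (fderiv ℂ τ z (Pi.single j 1) a) * dzbar a F (τ z) := by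
  rw [dzbar, fderiv_comp_holomorphic hF hτ, fderiv_comp_holomorphic hF hτ, single_I, map_smul,
    fderiv_apply_eq_sum, fderiv_apply_eq_sum, Finset.mul_sum, ← Finset.sum_add_distrib,
    Finset.mul_sum]
  refine Finset.sum_congr rfl fun a _ => ?_
  simp only [Pi.smul_apply, smul_eq_mul, map_mul, conj_I]
  linear_combination ((1 / 2 : ℂ) * fderiv ℂ τ z (Pi.single j 1) a * dz a F (τ z)
    - (1 / 2 : ℂ) * (starRingEnd ℂ) (fderiv ℂ τ z (Pi.single j 1) a) * dzbar a F (τ z)) * I_sq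

theorem dzbar_holomorphic (hF : DifferentiableAt ℂ F z) (j : Fin n) : dzbar j F z = 0 := by
  rw [dzbar, hF.fderiv_restrictScalars ℝ, ContinuousLinearMap.coe_restrictScalars', single_I,
    map_smul, smul_eq_mul]
  linear_combination (1 / 2 * fderiv ℂ F z (Pi.single j 1)) * I_sq

end chain

/-! ### Calculus of matrix-valued functions -/

/-- The matrix-valued function `H` has entries of class `C^m` (over `ℝ`) at `z`. -/
def MatContDiffAt (m : ℕ∞ω) (H : (Fin n → ℂ) → Matrix (Fin n) (Fin n) ℂ) (z : Fin n → ℂ) : Prop :=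
  ∀ a b, ContDiffAt ℝ m (fun x => H x a b) z

/-- The operator `wirt s j` applied to each entry of a matrix-valued function. -/
def wirtM (s : ℂ) (j : Fin n) (H : (Fin n → ℂ) → Matrix (Fin n) (Fin n) ℂ) (z : Fin n → ℂ) :
    Matrix (Fin n) (Fin n) ℂ :=
  Matrix.of fun a b => wirt s j (fun x => H x a b) z

section rules

variable {s t : ℂ} {j k : Fin n} {A B : (Fin n → ℂ) → Matrix (Fin n) (Fin n) ℂ} {z : Fin n → ℂ}
  {m m' : ℕ∞ω}

theorem MatContDiffAt.of_le (hA : MatContDiffAt m' A z) (h : m ≤ m') : MatContDiffAt m A z :=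
  fun a b => (hA a b).of_le h

theorem MatContDiffAt.differentiableAt (hA : MatContDiffAt m A z) (hm : 1 ≤ m) (a b : Fin n) :
    DifferentiableAt ℝ (fun x => A x a b) z :=
  (hA a b).differentiableAt (by rintro rfl; simp at hm)

theorem MatContDiffAt.wirtM (hA : MatContDiffAt m' A z) (h : m + 1 ≤ m') :
    MatContDiffAt m (wirtM s j A) z :=
  fun a b => (hA a b).wirt h

theorem MatContDiffAt.add (hA : MatContDiffAt m A z) (hB : MatContDiffAt m B z) :
    MatContDiffAt m (fun x => A x + B x) z :=
  fun a b => (hA a b).add (hB a b)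

theorem MatContDiffAt.mul (hA : MatContDiffAt m A z) (hB : MatContDiffAt m B z) :
    MatContDiffAt m (fun x => A x * B x) z := by
  intro a b
  simp only [Matrix.mul_apply]
  exact ContDiffAt.sum fun c _ => (hA a c).mul (hB c b)

theorem MatContDiffAt.trace (hA : MatContDiffAt m A z) :
    ContDiffAt ℝ m (fun x => (A x).trace) z := by
  simp only [Matrix.trace]
  exact ContDiffAt.sum fun c _ => hA c c

theorem MatContDiffAt.det (hA : MatContDiffAt m A z) :
    ContDiffAt ℝ m (fun x => (A x).det) z := by
  simp only [Matrix.det_apply']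
  exact ContDiffAt.sum fun σ _ => contDiffAt_const.mul (contDiffAt_prod fun i _ => hA _ _)

theorem MatContDiffAt.inv (hA : MatContDiffAt m A z) (hz : IsUnit (A z).det) :
    MatContDiffAt m (fun x => (A x)⁻¹) z := by
  intro a b
  simp only [Matrix.inv_def, Matrix.smul_apply, Ring.inverse_eq_inv', smul_eq_mul,
    Matrix.adjugate_apply]
  refine (hA.det.inv hz.ne_zero).mul (MatContDiffAt.det (A := fun x => (A x).updateRow b _) ?_)
  intro c d
  by_cases h : c = b
  · subst h
    simpa using contDiffAt_const
  · simpa [Matrix.updateRow_ne h] using hA c d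

theorem wirtM_congr_of_eqOn {U : Set (Fin n → ℂ)} (hU : IsOpen U) (hz : z ∈ U)
    (h : Set.EqOn A B U) : wirtM s j A z = wirtM s j B z := by
  ext a b
  exact wirt_congr_of_eqOn hU hz fun x hx => by simp only [h hx]

theorem wirtM_add (hA : MatContDiffAt 1 A z) (hB : MatContDiffAt 1 B z) :
    wirtM s j (fun x => A x + B x) z = wirtM s j A z + wirtM s j B z := by
  ext a b
  exact wirt_add (hA.differentiableAt le_rfl a b) (hB.differentiableAt le_rfl a b)

theorem wirtM_mul (hA : MatContDiffAt 1 A z) (hB : MatContDiffAt 1 B z) :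
    wirtM s j (fun x => A x * B x) z = wirtM s j A z * B z + A z * wirtM s j B z := by
  ext a b
  simp only [wirtM, Matrix.mul_apply, Matrix.of_apply, Matrix.add_apply,
    ← Finset.sum_add_distrib]
  rw [wirt_sum _ fun c _ =>
    (hA.differentiableAt le_rfl a c).fun_mul (hB.differentiableAt le_rfl c b)]
  exact Finset.sum_congr rfl fun c _ =>
    wirt_mul (hA.differentiableAt le_rfl a c) (hB.differentiableAt le_rfl c b)

theorem wirt_trace (hA : MatContDiffAt 1 A z) :
    wirt s j (fun x => (A x).trace) z = (wirtM s j A z).trace := by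
  simp only [Matrix.trace]
  exact wirt_sum _ fun c _ => hA.differentiableAt le_rfl c c

theorem isUnit_det_eventually (hA : MatContDiffAt m A z) (hz : IsUnit (A z).det) :
    ∀ᶠ x in 𝓝 z, IsUnit (A x).det := by
  filter_upwards [hA.det.continuousAt.eventually_ne hz.ne_zero] with x hx
  exact isUnit_iff_ne_zero.2 hx

theorem wirtM_inv (hA : MatContDiffAt 1 A z) (hz : IsUnit (A z).det) :
    wirtM s j (fun x => (A x)⁻¹) z = -((A z)⁻¹ * wirtM s j A z * (A z)⁻¹) := by
  have h1 : wirtM s j (fun x => (A x)⁻¹ * A x) z = 0 := by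
    ext a b
    have : (fun x => ((A x)⁻¹ * A x) a b) =ᶠ[𝓝 z] fun _ => (1 : Matrix (Fin n) (Fin n) ℂ) a b := by
      filter_upwards [isUnit_det_eventually hA hz] with x hx
      rw [Matrix.nonsing_inv_mul _ hx]
    simp only [wirtM, Matrix.of_apply, wirt_congr this, wirt_const, Matrix.zero_apply]
  rw [wirtM_mul (hA.inv hz) hA] at h1
  have h2 := congrArg (· * (A z)⁻¹) h1
  simp only [add_mul, zero_mul, Matrix.mul_assoc, Matrix.mul_nonsing_inv _ hz, Matrix.mul_one] at h2
  rw [Matrix.mul_assoc]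
  exact eq_neg_of_add_eq_zero_left h2

/-- Jacobi's formula. -/
theorem wirt_det (hA : MatContDiffAt 1 A z) (hz : IsUnit (A z).det) :
    wirt s j (fun x => (A x).det) z = (A z).det * ((A z)⁻¹ * wirtM s j A z).trace := by
  have hd := fun a b => hA.differentiableAt le_rfl a b
  have hp : ∀ σ : Equiv.Perm (Fin n), DifferentiableAt ℝ (fun x => ∏ i, A x (σ i) i) z := fun σ =>
    (contDiffAt_prod (n := 1) fun i _ => hA (σ i) i).differentiableAt (by norm_num)
  have h1 : wirt s j (fun x => (A x).det) z
      = ∑ i, ((A z).updateCol i fun a => wirtM s j A z a i).det := by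
    simp only [Matrix.det_apply']
    rw [wirt_sum _ fun σ _ => (hp σ).const_mul _, Finset.sum_comm]
    refine Finset.sum_congr rfl fun σ _ => ?_
    rw [wirt_mul (differentiableAt_const _) (hp σ), wirt_const, zero_mul, zero_add,
      wirt_prod _ fun i _ => hd (σ i) i, Finset.mul_sum]
    refine Finset.sum_congr rfl fun i _ => ?_
    rw [← Finset.mul_prod_erase Finset.univ _ (Finset.mem_univ i), Matrix.updateCol_self]
    congr 1
    rw [mul_comm]
    congr 1
    refine Finset.prod_congr rfl fun m hm => ?_
    rw [Matrix.updateCol_ne (Finset.ne_of_mem_erase hm)]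
  have h2 : (A z).det • (A z)⁻¹ = (A z).adjugate := by
    rw [Matrix.inv_def, smul_smul, Ring.mul_inverse_cancel _ hz, one_smul]
  rw [h1, ← smul_eq_mul, ← Matrix.trace_smul, ← Matrix.smul_mul, h2, Matrix.trace]
  refine Finset.sum_congr rfl fun i _ => ?_
  rw [← Matrix.cramer_apply, Matrix.cramer_eq_adjugate_mulVec, Matrix.diag_apply,
    Matrix.mul_apply]
  rfl

theorem wirtM_conjTranspose :
    wirtM s j (fun x => (A x)ᴴ) z = (wirtM (-(starRingEnd ℂ) s) j A z)ᴴ := by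
  ext a b
  exact wirt_conj

theorem wirtM_comm (hA : MatContDiffAt 2 A z) :
    wirtM s j (wirtM t k A) z = wirtM t k (wirtM s j A) z := by
  ext a b
  exact wirt_comm (hA a b)

end rules

/-- The curvature `-∂ₖ∂_{l̄} H + ∂ₖH H⁻¹ ∂_{l̄}H` of a matrix-valued function `H`, in the indices
`i`, `j̄`. -/
def matCurv (H : (Fin n → ℂ) → Matrix (Fin n) (Fin n) ℂ) (k l : Fin n) (z : Fin n → ℂ) :
    Matrix (Fin n) (Fin n) ℂ :=
  wirtM (-1) k H z * (H z)⁻¹ * wirtM 1 l H z - wirtM (-1) k (wirtM 1 l H) z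

section second

variable {G H : (Fin n → ℂ) → Matrix (Fin n) (Fin n) ℂ} {z : Fin n → ℂ} {k l : Fin n}

/-- The covariant derivative `∇ₖ H` of `H` with respect to the Chern connection of `G`. -/
def covDeriv (G H : (Fin n → ℂ) → Matrix (Fin n) (Fin n) ℂ) (k : Fin n) (z : Fin n → ℂ) :
    Matrix (Fin n) (Fin n) ℂ :=
  wirtM (-1) k H z - wirtM (-1) k G z * (G z)⁻¹ * H z

theorem wirt_trace_inv_mul {s : ℂ} (hG : MatContDiffAt 1 G z) (hH : MatContDiffAt 1 H z)
    (hGu : IsUnit (G z).det) :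
    wirt s k (fun x => ((G x)⁻¹ * H x).trace) z
      = ((G z)⁻¹ * (wirtM s k H z - wirtM s k G z * (G z)⁻¹ * H z)).trace := by
  rw [wirt_trace ((hG.inv hGu).mul hH), wirtM_mul (hG.inv hGu) hH, wirtM_inv hG hGu]
  congr 1
  noncomm_ring

/-- The mixed second derivative of `tr (G⁻¹ H)`, before it is sorted into curvature terms. -/
theorem wirt_wirt_trace_inv_mul {s t : ℂ} (hG : MatContDiffAt 2 G z) (hH : MatContDiffAt 2 H z)
    (hGu : IsUnit (G z).det) :
    wirt s k (wirt t l fun x => ((G x)⁻¹ * H x).trace) z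
      = ((G z)⁻¹ * (wirtM s k (wirtM t l H) z
          - wirtM s k G z * (G z)⁻¹ * wirtM t l H z - wirtM t l G z * (G z)⁻¹ * wirtM s k H z
          - wirtM s k (wirtM t l G) z * (G z)⁻¹ * H z
          + wirtM s k G z * (G z)⁻¹ * wirtM t l G z * (G z)⁻¹ * H z
          + wirtM t l G z * (G z)⁻¹ * wirtM s k G z * (G z)⁻¹ * H z)).trace := by
  have hG1 : MatContDiffAt 1 G z := hG.of_le (by norm_num)
  have hH1 : MatContDiffAt 1 H z := hH.of_le (by norm_num)
  have hGt : MatContDiffAt 1 (wirtM t l G) z := hG.wirtM (by norm_num)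
  have hHt : MatContDiffAt 1 (wirtM t l H) z := hH.wirtM (by norm_num)
  have hGi := hG1.inv hGu
  have e : (wirt t l fun x => ((G x)⁻¹ * H x).trace) =ᶠ[𝓝 z] fun x =>
      ((G x)⁻¹ * wirtM t l H x).trace + -((G x)⁻¹ * wirtM t l G x * ((G x)⁻¹ * H x)).trace := by
    have c1 : ∀ᶠ x in 𝓝 z, MatContDiffAt 1 G x := by
      simp only [MatContDiffAt, Filter.eventually_all]
      exact fun a b => (hG1 a b).eventually (by simp)
    have c2 : ∀ᶠ x in 𝓝 z, MatContDiffAt 1 H x := by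
      simp only [MatContDiffAt, Filter.eventually_all]
      exact fun a b => (hH1 a b).eventually (by simp)
    filter_upwards [c1, c2, isUnit_det_eventually hG hGu] with x h1 h2 h3
    rw [wirt_trace_inv_mul h1 h2 h3, mul_sub, Matrix.trace_sub, sub_eq_add_neg]
    simp only [Matrix.mul_assoc]
  have d1 := hGi.mul hHt
  have d2 := (hGi.mul hGt).mul (hGi.mul hH1)
  rw [wirt_congr e, wirt_add (d1.trace.differentiableAt (by norm_num))
    (d2.trace.differentiableAt (by norm_num)).fun_neg, wirt_neg, wirt_trace d1, wirt_trace d2,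
    wirtM_mul hGi hHt, wirtM_mul (hGi.mul hGt) (hGi.mul hH1), wirtM_mul hGi hGt, wirtM_mul hGi hH1,
    wirtM_inv hG1 hGu, ← sub_eq_add_neg, ← Matrix.trace_sub]
  congr 1
  noncomm_ring

/-- The trace of the complex Hessian of `tr_G H` splits into the two curvatures and the square of
the covariant derivative. This replaces the computation in normal coordinates. -/
theorem wirt_wirt_trace_eq_curvature (hG : MatContDiffAt 2 G z) (hH : MatContDiffAt 2 H z)
    (hGu : IsUnit (G z).det) (hHu : IsUnit (H z).det)
    (hGh : ∀ᶠ x in 𝓝 z, (G x).IsHermitian) (hHh : ∀ᶠ x in 𝓝 z, (H x).IsHermitian) :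
    wirt (-1) k (wirt 1 l fun x => ((G x)⁻¹ * H x).trace) z
      = ((G z)⁻¹ * matCurv G k l z * (G z)⁻¹ * H z).trace
        + ((G z)⁻¹ * covDeriv G H k z * (H z)⁻¹ * (covDeriv G H l z)ᴴ).trace
        - ((G z)⁻¹ * matCurv H k l z).trace := by
  have herm : ∀ {A : (Fin n → ℂ) → Matrix (Fin n) (Fin n) ℂ},
      (∀ᶠ x in 𝓝 z, (A x).IsHermitian) → (wirtM (-1) l A z)ᴴ = wirtM 1 l A z := by
    intro A hA
    have h1 : wirtM 1 l (fun x => (A x)ᴴ) z = (wirtM (-1) l A z)ᴴ := by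
      rw [wirtM_conjTranspose]; simp
    rw [← h1]
    ext a b
    refine wirt_congr ?_
    filter_upwards [hA] with x hx
    rw [hx.eq]
  have hbar : (covDeriv G H l z)ᴴ = wirtM 1 l H z - H z * (G z)⁻¹ * wirtM 1 l G z := by
    rw [covDeriv, Matrix.conjTranspose_sub, Matrix.conjTranspose_mul, Matrix.conjTranspose_mul,
      herm hGh, herm hHh, hHh.self_of_nhds.eq, hGh.self_of_nhds.inv.eq, Matrix.mul_assoc]
  rw [wirt_wirt_trace_inv_mul hG hH hGu, hbar]
  simp only [matCurv, covDeriv]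
  generalize wirtM (-1) k (wirtM 1 l H) z = H2
  generalize wirtM (-1) k (wirtM 1 l G) z = G2
  generalize wirtM (-1) k H z = Hk
  generalize wirtM (-1) k G z = Gk
  generalize wirtM 1 l H z = Hl
  generalize wirtM 1 l G z = Gl
  have hHH : ∀ X, H z * ((H z)⁻¹ * X) = X := fun X => by
    rw [← Matrix.mul_assoc, Matrix.mul_nonsing_inv _ hHu, Matrix.one_mul]
  have hHH' : ∀ X, (H z)⁻¹ * (H z * X) = X := fun X => by
    rw [← Matrix.mul_assoc, Matrix.nonsing_inv_mul _ hHu, Matrix.one_mul]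
  simp only [mul_sub, sub_mul, mul_add, Matrix.mul_assoc, hHH, hHH', Matrix.trace_sub,
    Matrix.trace_add]
  have c1 : ((G z)⁻¹ * (Gk * ((G z)⁻¹ * (H z * ((G z)⁻¹ * Gl))))).trace
      = ((G z)⁻¹ * (Gl * ((G z)⁻¹ * (Gk * ((G z)⁻¹ * H z))))).trace := by
    have := Matrix.trace_mul_comm ((G z)⁻¹ * Gk * (G z)⁻¹ * H z) ((G z)⁻¹ * Gl)
    simpa only [Matrix.mul_assoc] using this
  have c2 : ((G z)⁻¹ * (Hk * ((G z)⁻¹ * Gl))).trace = ((G z)⁻¹ * (Gl * ((G z)⁻¹ * Hk))).trace := by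
    have := Matrix.trace_mul_comm ((G z)⁻¹ * Hk) ((G z)⁻¹ * Gl)
    simpa only [Matrix.mul_assoc] using this
  rw [c1, c2]
  ring

/-- The Ricci form is minus the complex Hessian of the logarithm of the determinant. -/
theorem wirt_trace_inv_mul_wirtM (hH : MatContDiffAt 2 H z) (hHu : IsUnit (H z).det) :
    wirt (-1) k (fun x => ((H x)⁻¹ * wirtM 1 l H x).trace) z
      = -((H z)⁻¹ * matCurv H k l z).trace := by
  have hH1 : MatContDiffAt 1 H z := hH.of_le (by norm_num)
  have hHt : MatContDiffAt 1 (wirtM 1 l H) z := hH.wirtM (by norm_num)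
  rw [wirt_trace_inv_mul hH1 hHt hHu, ← Matrix.trace_neg, matCurv]
  congr 1
  noncomm_ring

end second

/-! ### Kähler metrics on open sets of `ℂⁿ` -/

theorem wirt_cexp {s : ℂ} {j : Fin n} {F : (Fin n → ℂ) → ℂ} {z : Fin n → ℂ}
    (hF : DifferentiableAt ℝ F z) :
    wirt s j (fun x => exp (F x)) z = exp (F z) * wirt s j F z := by
  have h : fderiv ℝ (fun x => exp (F x)) z = exp (F z) • fderiv ℝ F z :=
    hF.hasFDerivAt.cexp.fderiv
  simp only [wirt, h, _root_.smul_apply, smul_eq_mul]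
  ring

/-- The second derivatives of `F` in terms of those of `y = exp F`: `y ∂∂̄F = ∂∂̄y - ∂y ∂̄y / y`. In
this form no branch of the complex logarithm has to be differentiated. -/
theorem exp_mul_wirt_wirt {s t : ℂ} {j k : Fin n} {F : (Fin n → ℂ) → ℂ} {z : Fin n → ℂ}
    (hF : ContDiffAt ℝ 2 F z) :
    exp (F z) * wirt s j (wirt t k F) z = wirt s j (wirt t k fun x => exp (F x)) z
      - wirt s j (fun x => exp (F x)) z * wirt t k (fun x => exp (F x)) z / exp (F z) := by
  have hF1 : ContDiffAt ℝ 1 F z := hF.of_le (by norm_num)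
  have hd : DifferentiableAt ℝ F z := hF.differentiableAt (by norm_num)
  have e : wirt t k (fun x => exp (F x)) =ᶠ[𝓝 z] fun x => exp (F x) * wirt t k F x := by
    filter_upwards [hF1.eventually (by simp)] with x hx
    exact wirt_cexp (hx.differentiableAt (by norm_num))
  have hw : ContDiffAt ℝ 1 (wirt t k F) z := hF.wirt (by norm_num)
  rw [wirt_congr e, wirt_mul hd.cexp (hw.differentiableAt (by norm_num)), wirt_cexp hd,
    wirt_cexp hd]
  field_simp [exp_ne_zero]
  ring

/-- The matrix-valued function `H` is the coefficient matrix of a Kähler metric of class `C²` on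
`U ⊆ ℂⁿ`. -/
structure IsKahlerOn (U : Set (Fin n → ℂ)) (H : (Fin n → ℂ) → Matrix (Fin n) (Fin n) ℂ) :
    Prop where
  contDiffAt : ∀ z ∈ U, MatContDiffAt 2 H z
  posDef : ∀ z ∈ U, (H z).PosDef
  closed : ∀ z ∈ U, ∀ i j k, wirt (-1) k (fun x => H x i j) z = wirt (-1) i (fun x => H x k j) z

namespace IsKahlerOn

variable {U : Set (Fin n → ℂ)} {G H : (Fin n → ℂ) → Matrix (Fin n) (Fin n) ℂ} {z : Fin n → ℂ}

theorem isUnit_det (hH : IsKahlerOn U H) (hz : z ∈ U) : IsUnit (H z).det :=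
  (Matrix.isUnit_iff_isUnit_det _).1 (hH.posDef z hz).isUnit

theorem isHermitian_eventually (hH : IsKahlerOn U H) (hU : IsOpen U) (hz : z ∈ U) :
    ∀ᶠ x in 𝓝 z, (H x).IsHermitian := by
  filter_upwards [hU.mem_nhds hz] with x hx
  exact (hH.posDef x hx).isHermitian

theorem wirt_one (hH : IsKahlerOn U H) (hU : IsOpen U) (hz : z ∈ U) (i j k : Fin n) :
    wirt 1 k (fun x => H x i j) z = (starRingEnd ℂ) (wirt (-1) k (fun x => H x j i) z) := by
  have : (fun x => H x i j) =ᶠ[𝓝 z] fun x => (starRingEnd ℂ) (H x j i) := by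
    filter_upwards [hH.isHermitian_eventually hU hz] with x hx
    exact (hx.apply i j).symm
  rw [wirt_congr this, wirt_conj]
  simp

theorem closed_bar (hH : IsKahlerOn U H) (hU : IsOpen U) (hz : z ∈ U) (i j l : Fin n) :
    wirt 1 l (fun x => H x i j) z = wirt 1 j (fun x => H x i l) z := by
  rw [hH.wirt_one hU hz, hH.wirt_one hU hz, hH.closed z hz]

/-- The curvature of a Kähler metric is symmetric under exchange of the index pairs `ij̄`, `kl̄`. -/
theorem matCurv_symm (hH : IsKahlerOn U H) (hU : IsOpen U) (hz : z ∈ U) (i j k l : Fin n) :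
    matCurv H k l z i j = matCurv H i j z k l := by
  have h1 : wirtM (-1) k (wirtM 1 l H) z i j = wirtM (-1) i (wirtM 1 j H) z k l := by
    calc wirt (-1) k (wirt 1 l fun x => H x i j) z
        = wirt (-1) k (wirt 1 j fun x => H x i l) z :=
          wirt_congr_of_eqOn hU hz fun x hx => hH.closed_bar hU hx i j l
      _ = wirt 1 j (wirt (-1) k fun x => H x i l) z := wirt_comm (hH.contDiffAt z hz _ _)
      _ = wirt 1 j (wirt (-1) i fun x => H x k l) z :=
          wirt_congr_of_eqOn hU hz fun x hx => hH.closed x hx i l k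
      _ = wirt (-1) i (wirt 1 j fun x => H x k l) z := wirt_comm (hH.contDiffAt z hz _ _)
  have h2 : ∀ s, wirtM (-1) k H z i s = wirtM (-1) i H z k s := fun s => hH.closed z hz i s k
  have h3 : ∀ r, wirtM 1 l H z r j = wirtM 1 j H z r l := fun r => hH.closed_bar hU hz r j l
  simp only [matCurv, Matrix.sub_apply, Matrix.mul_apply, h1, h2, h3]

/-- Contracting the curvature of `H` with `G⁻¹` and `H⁻¹` in either pair of indices. -/
theorem sum_inv_mul_trace_matCurv (hH : IsKahlerOn U H) (hU : IsOpen U) (hz : z ∈ U)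
    (A B : Matrix (Fin n) (Fin n) ℂ) :
    ∑ k, ∑ l, A l k * (B * matCurv H k l z).trace
      = ∑ i, ∑ j, B j i * (A * matCurv H i j z).trace := by
  simp only [Matrix.trace, Matrix.diag_apply, Matrix.mul_apply, Finset.mul_sum]
  have e : ∀ C D : Matrix (Fin n) (Fin n) ℂ,
      ∑ k, ∑ l, ∑ j, ∑ i, C l k * (D j i * matCurv H k l z i j)
        = ∑ x : Fin n × Fin n, ∑ y : Fin n × Fin n,
          C x.2 x.1 * (D y.2 y.1 * matCurv H x.1 x.2 z y.1 y.2) := by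
    intro C D
    simp only [Fintype.sum_prod_type]
    exact Finset.sum_congr rfl fun k _ => Finset.sum_congr rfl fun l _ => Finset.sum_comm
  rw [e, e, Finset.sum_comm]
  refine Finset.sum_congr rfl fun x _ => Finset.sum_congr rfl fun y _ => ?_
  rw [hH.matCurv_symm hU hz]
  ring

variable {F : (Fin n → ℂ) → ℂ}

/-- The Ricci forms of two Kähler metrics with `det H = e^F det G` differ by `∂∂̄F`; the equation is
differentiated by Jacobi's formula. -/
theorem trace_matCurv_of_det_eq (hG : IsKahlerOn U G) (hH : IsKahlerOn U H) (hU : IsOpen U)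
    (hz : z ∈ U) (hF : ∀ x ∈ U, ContDiffAt ℝ 2 F x)
    (hdet : ∀ x ∈ U, (H x).det = exp (F x) * (G x).det) (k l : Fin n) :
    ((H z)⁻¹ * matCurv H k l z).trace
      = ((G z)⁻¹ * matCurv G k l z).trace - wirt (-1) k (wirt 1 l F) z := by
  have h1 : ∀ x ∈ U, ((H x)⁻¹ * wirtM 1 l H x).trace
      = wirt 1 l F x + ((G x)⁻¹ * wirtM 1 l G x).trace := by
    intro x hx
    have hFx : DifferentiableAt ℝ F x := (hF x hx).differentiableAt (by norm_num)
    have hGx := (hG.contDiffAt x hx).of_le (m := 1) (by norm_num)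
    have hHx := (hH.contDiffAt x hx).of_le (m := 1) (by norm_num)
    have := wirt_congr_of_eqOn (s := 1) (j := l) hU hx hdet
    rw [wirt_det hHx (hH.isUnit_det hx), wirt_mul hFx.cexp
      (hGx.det.differentiableAt (by norm_num)), wirt_det hGx (hG.isUnit_det hx), wirt_cexp hFx,
      hdet x hx] at this
    refine mul_left_cancel₀ (mul_ne_zero (exp_ne_zero (F x)) (hG.isUnit_det hx).ne_zero) ?_
    rw [this]
    ring
  have hG2 := hG.contDiffAt z hz
  have h2 := wirt_congr_of_eqOn (s := -1) (j := k) hU hz h1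
  rw [wirt_trace_inv_mul_wirtM (hH.contDiffAt z hz) (hH.isUnit_det hz), wirt_add
    (((hF z hz).wirt (m := 1) (by norm_num)).differentiableAt (by norm_num))
    ((((hG2.of_le (by norm_num)).inv (hG.isUnit_det hz)).mul
      (hG2.wirtM (m := 1) (by norm_num))).trace.differentiableAt (by norm_num)),
    wirt_trace_inv_mul_wirtM hG2 (hG.isUnit_det hz)] at h2
  linear_combination -h2

/-- The second order identity for the Laplacian of `y = tr_G H` with respect to `H`, when the
determinants of the two Kähler metrics are related by `det H = e^F det G`. -/
theorem sum_inv_mul_wirt_wirt_trace (hG : IsKahlerOn U G) (hH : IsKahlerOn U H) (hU : IsOpen U)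
    (hz : z ∈ U) (hF : ∀ x ∈ U, ContDiffAt ℝ 2 F x)
    (hdet : ∀ x ∈ U, (H x).det = exp (F x) * (G x).det) :
    ∑ k, ∑ l, (H z)⁻¹ l k * wirt (-1) k (wirt 1 l fun x => ((G x)⁻¹ * H x).trace) z
      = ∑ k, ∑ l, (G z)⁻¹ l k * wirt (-1) k (wirt 1 l F) z
        + (∑ k, ∑ l, (H z)⁻¹ l k * ((G z)⁻¹ * matCurv G k l z * (G z)⁻¹ * H z).trace
          - ∑ k, ∑ l, (G z)⁻¹ l k * ((G z)⁻¹ * matCurv G k l z).trace)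
        + ∑ k, ∑ l, (H z)⁻¹ l k
          * ((G z)⁻¹ * covDeriv G H k z * (H z)⁻¹ * (covDeriv G H l z)ᴴ).trace := by
  have h1 : ∑ k, ∑ l, (H z)⁻¹ l k * ((G z)⁻¹ * matCurv H k l z).trace
      = ∑ k, ∑ l, (G z)⁻¹ l k * ((G z)⁻¹ * matCurv G k l z).trace
        - ∑ k, ∑ l, (G z)⁻¹ l k * wirt (-1) k (wirt 1 l F) z := by
    rw [hH.sum_inv_mul_trace_matCurv hU hz]
    simp only [hG.trace_matCurv_of_det_eq hH hU hz hF hdet, mul_sub, Finset.sum_sub_distrib]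
  simp only [fun k l => wirt_wirt_trace_eq_curvature (k := k) (l := l) (hG.contDiffAt z hz)
    (hH.contDiffAt z hz) (hG.isUnit_det hz) (hH.isUnit_det hz) (hG.isHermitian_eventually hU hz)
    (hH.isHermitian_eventually hU hz), mul_sub, mul_add, Finset.sum_sub_distrib,
    Finset.sum_add_distrib]
  linear_combination -h1

end IsKahlerOn

/-! ### Simultaneous diagonalization and the pointwise inequalities -/

/-- A positive definite matrix is unitarily congruent to a positive diagonal matrix. -/
theorem Matrix.PosDef.exists_unitary_diagonal {G : Matrix (Fin n) (Fin n) ℂ} (hG : G.PosDef) :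
    ∃ (U : Matrix (Fin n) (Fin n) ℂ) (lam : Fin n → ℝ), (∀ i, 0 < lam i) ∧ U * Uᴴ = 1 ∧
      U * G * Uᴴ = Matrix.diagonal fun i => (lam i : ℂ) := by
  set V := (hG.isHermitian.eigenvectorUnitary : Matrix (Fin n) (Fin n) ℂ) with hV
  have h1 : Vᴴ * V = 1 := Unitary.coe_star_mul_self hG.isHermitian.eigenvectorUnitary
  have hs := hG.isHermitian.spectral_theorem
  rw [Unitary.conjStarAlgAut_apply] at hs
  have hs' : G = V * (Matrix.diagonal fun i => (hG.isHermitian.eigenvalues i : ℂ)) * Vᴴ := hs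
  refine ⟨Vᴴ, hG.isHermitian.eigenvalues, hG.eigenvalues_pos, by simpa using h1, ?_⟩
  set D := (Matrix.diagonal fun i => (hG.isHermitian.eigenvalues i : ℂ))
  rw [hs', Matrix.conjTranspose_conjTranspose]
  calc Vᴴ * (V * D * Vᴴ) * V = (Vᴴ * V) * D * (Vᴴ * V) := by simp only [Matrix.mul_assoc]
    _ = D := by rw [h1, Matrix.one_mul, Matrix.mul_one]

theorem Matrix.PosDef.congr_of_isUnit {H Q : Matrix (Fin n) (Fin n) ℂ} (hH : H.PosDef)
    (hQ : IsUnit Q) : (Q * H * Qᴴ).PosDef :=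
  hH.mul_mul_conjTranspose_same (Matrix.vecMul_injective_iff_isUnit.2 hQ)

/-- Two positive definite Hermitian forms have a common basis, given by the rows of `Q`, that is
orthonormal for the first and orthogonal for the second. -/
theorem exists_simultaneous_diagonalization {G H : Matrix (Fin n) (Fin n) ℂ} (hG : G.PosDef)
    (hH : H.PosDef) :
    ∃ (Q : Matrix (Fin n) (Fin n) ℂ) (lam : Fin n → ℝ), (∀ i, 0 < lam i) ∧ IsUnit Q ∧
      Q * G * Qᴴ = 1 ∧ Q * H * Qᴴ = Matrix.diagonal fun i => (lam i : ℂ) := by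
  obtain ⟨U, μ, hμ, hU, hUG⟩ := hG.exists_unitary_diagonal
  set E : Matrix (Fin n) (Fin n) ℂ := Matrix.diagonal fun i => ((Real.sqrt (μ i))⁻¹ : ℂ) with hE
  have hsq : ∀ i, ((Real.sqrt (μ i) : ℝ) : ℂ) * (Real.sqrt (μ i) : ℝ) = μ i := fun i => by
    rw [← ofReal_mul, Real.mul_self_sqrt (hμ i).le]
  have hne : ∀ i, ((Real.sqrt (μ i) : ℝ) : ℂ) ≠ 0 := fun i => by
    exact_mod_cast (Real.sqrt_pos.2 (hμ i)).ne'
  have hEH : Eᴴ = E := by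
    rw [hE, Matrix.diagonal_conjTranspose]
    congr 1
    funext i
    simp
  have hQ₀ : (E * U) * G * (E * U)ᴴ = 1 := by
    rw [Matrix.conjTranspose_mul, hEH]
    calc E * U * G * (Uᴴ * E) = E * (U * G * Uᴴ) * E := by simp only [Matrix.mul_assoc]
      _ = 1 := by
        rw [hUG, hE, Matrix.diagonal_mul_diagonal, Matrix.diagonal_mul_diagonal,
          ← Matrix.diagonal_one]
        congr 1
        funext i
        rw [← hsq i]
        field_simp [hne i]
  have hEu : IsUnit E := by
    rw [hE, Matrix.isUnit_diagonal, Pi.isUnit_iff]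
    exact fun i => isUnit_iff_ne_zero.2 (inv_ne_zero (hne i))
  have hUu : IsUnit U := IsUnit.of_mul_eq_one _ hU
  have hQu : IsUnit (E * U) := hEu.mul hUu
  obtain ⟨V, lam, hlam, hV, hVH⟩ := (hH.congr_of_isUnit hQu).exists_unitary_diagonal
  have hVu : IsUnit V := IsUnit.of_mul_eq_one _ hV
  refine ⟨V * (E * U), lam, hlam, hVu.mul hQu, ?_, ?_⟩
  · calc V * (E * U) * G * (V * (E * U))ᴴ = V * ((E * U) * G * (E * U)ᴴ) * Vᴴ := by
          simp only [Matrix.conjTranspose_mul, Matrix.mul_assoc]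
      _ = 1 := by rw [hQ₀, Matrix.mul_one, hV]
  · rw [← hVH]
    simp only [Matrix.conjTranspose_mul, Matrix.mul_assoc]

theorem inv_eq_of_congr_diagonal {Q H : Matrix (Fin n) (Fin n) ℂ} {d : Fin n → ℂ} (hQ : IsUnit Q)
    (hd : ∀ i, d i ≠ 0) (h : Q * H * Qᴴ = Matrix.diagonal d) :
    H⁻¹ = Qᴴ * Matrix.diagonal (fun i => (d i)⁻¹) * Q := by
  have hQd : IsUnit Q.det := (Matrix.isUnit_iff_isUnit_det _).1 hQ
  have hQd' : IsUnit Qᴴ.det := by rw [Matrix.det_conjTranspose]; exact hQd.star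
  have h1 : Qᴴ * Matrix.diagonal (fun i => (d i)⁻¹) * Q * (H * Qᴴ) = 1 * Qᴴ := by
    calc Qᴴ * Matrix.diagonal (fun i => (d i)⁻¹) * Q * (H * Qᴴ)
        = Qᴴ * (Matrix.diagonal (fun i => (d i)⁻¹) * (Q * H * Qᴴ)) := by
          simp only [Matrix.mul_assoc]
      _ = 1 * Qᴴ := by
          rw [h, Matrix.diagonal_mul_diagonal]
          simp [hd]
  refine Matrix.inv_eq_left_inv ?_
  rw [← Matrix.mul_assoc] at h1
  have h2 := congrArg (· * (Qᴴ)⁻¹) h1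
  simpa only [Matrix.mul_assoc, Matrix.mul_nonsing_inv _ hQd', Matrix.mul_one] using h2

/-- Contracting with the inverse of a diagonalized metric is a weighted sum over the frame given by
the rows of `Q`. -/
theorem sum_diagonal_congr_mul (Q : Matrix (Fin n) (Fin n) ℂ) (d : Fin n → ℂ)
    (T : Fin n → Fin n → ℂ) :
    ∑ k, ∑ l, (Qᴴ * Matrix.diagonal d * Q) l k * T k l
      = ∑ a, d a * ∑ k, ∑ l, Q a k * star (Q a l) * T k l := by
  have h : ∀ k l, (Qᴴ * Matrix.diagonal d * Q) l k
      = ∑ a, star (Q a l) * d a * Q a k := fun k l => by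
    rw [Matrix.mul_apply]
    exact Finset.sum_congr rfl fun a _ => by rw [Matrix.mul_diagonal, Matrix.conjTranspose_apply]
  simp only [h, Finset.sum_mul, Finset.mul_sum]
  rw [Finset.sum_congr rfl fun k _ => Finset.sum_comm, Finset.sum_comm]
  refine Finset.sum_congr rfl fun a _ => Finset.sum_congr rfl fun k _ =>
    Finset.sum_congr rfl fun l _ => by ring

theorem trace_mul_diagonal (A : Matrix (Fin n) (Fin n) ℂ) (d : Fin n → ℂ) :
    (A * Matrix.diagonal d).trace = ∑ i, A i i * d i := by
  simp [Matrix.trace, Matrix.mul_diagonal]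

/-- The weighted sums of a symmetric kernel bounded by `K` that arise from the curvature. -/
theorem curvature_sum_ge {lam : Fin n → ℝ} (hlam : ∀ i, 0 < lam i) {r : Fin n → Fin n → ℝ} {K : ℝ}
    (hr : ∀ a b, |r a b| ≤ K) (hsymm : ∀ a b, r a b = r b a) :
    -(K * ((∑ i, lam i) * (∑ i, (lam i)⁻¹) - (n : ℝ) ^ 2))
      ≤ (∑ a, (lam a)⁻¹ * ∑ b, lam b * r a b) - ∑ a, ∑ b, r a b := by
  have e1 : (∑ a, (lam a)⁻¹ * ∑ b, lam b * r a b) - ∑ a, ∑ b, r a b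
      = ∑ a, ∑ b, (lam b / lam a - 1) * r a b := by
    rw [← Finset.sum_sub_distrib]
    refine Finset.sum_congr rfl fun a _ => ?_
    rw [Finset.mul_sum, ← Finset.sum_sub_distrib]
    refine Finset.sum_congr rfl fun b _ => ?_
    ring
  have e2 : ∑ a, ∑ b, (lam b / lam a - 1) * r a b = ∑ a, ∑ b, (lam a / lam b - 1) * r a b := by
    rw [Finset.sum_comm]
    exact Finset.sum_congr rfl fun a _ => Finset.sum_congr rfl fun b _ => by rw [hsymm b a]
  have e3 : (∑ i, lam i) * (∑ i, (lam i)⁻¹) - (n : ℝ) ^ 2 = ∑ a, ∑ b, (lam a / lam b - 1) := by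
    rw [Finset.sum_mul_sum]
    simp only [Finset.sum_sub_distrib, div_eq_mul_inv]
    simp [sq]
  have e4 : ∑ a, ∑ b, (lam a / lam b - 1) = ∑ a, ∑ b, (lam b / lam a - 1) := Finset.sum_comm
  -- the symmetrized weights `λₐ/λ_b + λ_b/λₐ - 2` are nonnegative
  have key : ∑ a, ∑ b, -(K * ((lam a / lam b - 1) + (lam b / lam a - 1)))
      ≤ ∑ a, ∑ b, ((lam a / lam b - 1) + (lam b / lam a - 1)) * r a b := by
    refine Finset.sum_le_sum fun a _ => Finset.sum_le_sum fun b _ => ?_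
    have ha := hlam a
    have hb := hlam b
    have hpos : 0 ≤ (lam a / lam b - 1) + (lam b / lam a - 1) := by
      have : (lam a / lam b - 1) + (lam b / lam a - 1) = (lam a - lam b) ^ 2 / (lam a * lam b) := by
        field_simp; ring
      rw [this]; positivity
    have := (abs_le.1 (hr a b)).1
    nlinarith
  simp only [Finset.sum_neg_distrib, ← Finset.mul_sum, Finset.sum_add_distrib, add_mul] at key
  rw [← e4, ← e3, e2] at key
  rw [e1, e2]
  linarith

/-- Cauchy–Schwarz for the trace, with the weights `lam`. -/
theorem normSq_trace_le {lam : Fin n → ℝ} (hlam : ∀ i, 0 < lam i) (Y : Matrix (Fin n) (Fin n) ℂ) :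
    Complex.normSq Y.trace ≤ (∑ i, lam i) * ∑ b, ∑ c, Complex.normSq (Y b c) * (lam c)⁻¹ := by
  have h1 : Complex.normSq Y.trace ≤ (∑ b, ‖Y b b‖) ^ 2 := by
    rw [Complex.normSq_eq_norm_sq]
    exact pow_le_pow_left₀ (norm_nonneg _) (norm_sum_le _ _) 2
  have h2 : (∑ b, ‖Y b b‖) ^ 2 ≤ (∑ i, lam i) * ∑ b, Complex.normSq (Y b b) * (lam b)⁻¹ := by
    refine Finset.sum_sq_le_sum_mul_sum_of_sq_le_mul _ (fun i _ => (hlam i).le)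
      (fun i _ => mul_nonneg (Complex.normSq_nonneg _) (inv_nonneg.2 (hlam i).le)) fun i _ => ?_
    rw [Complex.normSq_eq_norm_sq]
    apply le_of_eq
    field_simp [(hlam i).ne']
  refine h1.trans (h2.trans (mul_le_mul_of_nonneg_left ?_
    (Finset.sum_nonneg fun i _ => (hlam i).le)))
  exact Finset.sum_le_sum fun b _ => Finset.single_le_sum
    (f := fun c => Complex.normSq (Y b c) * (lam c)⁻¹)
    (fun c _ => mul_nonneg (Complex.normSq_nonneg _) (inv_nonneg.2 (hlam c).le))
    (Finset.mem_univ b)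

section diagonalized

variable {G H Q : Matrix (Fin n) (Fin n) ℂ} {lam : Fin n → ℝ}

theorem sum_sum_mul_star_mul_trace (X : Fin n → Matrix (Fin n) (Fin n) ℂ)
    (D : Matrix (Fin n) (Fin n) ℂ) (a : Fin n) :
    ∑ k, ∑ l, Q a k * star (Q a l) * (X k * D * (X l)ᴴ).trace
      = ((∑ k, Q a k • X k) * D * (∑ k, Q a k • X k)ᴴ).trace := by
  simp only [Matrix.conjTranspose_sum, Matrix.conjTranspose_smul, Finset.sum_mul, Finset.mul_sum,
    Matrix.trace_sum, Matrix.smul_mul, Matrix.mul_smul, Matrix.trace_smul, smul_eq_mul]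
  rw [Finset.sum_comm]
  exact Finset.sum_congr rfl fun k _ => Finset.sum_congr rfl fun l _ => by ring

/-- The gradient inequality `|∂ tr_G H|² ≤ tr_G H · ∑ |∇H|²`, all contractions being taken as in
the formula for the Laplacian of `tr_G H`. -/
theorem gradient_inequality (hlam : ∀ i, 0 < lam i) (hQ : IsUnit Q) (hQG : Q * G * Qᴴ = 1)
    (hQH : Q * H * Qᴴ = Matrix.diagonal fun i => (lam i : ℂ))
    (X : Fin n → Matrix (Fin n) (Fin n) ℂ) :
    (∑ k, ∑ l, H⁻¹ l k * ((G⁻¹ * X k).trace * star (G⁻¹ * X l).trace)).re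
      ≤ (∑ i, lam i) * (∑ k, ∑ l, H⁻¹ l k * (G⁻¹ * X k * H⁻¹ * (X l)ᴴ).trace).re := by
  have hGi : G⁻¹ = Qᴴ * Q := by
    have := inv_eq_of_congr_diagonal (d := fun _ => 1) hQ (by simp) (by simpa using hQG)
    simpa using this
  have hHi := inv_eq_of_congr_diagonal hQ (fun i => by exact_mod_cast (hlam i).ne') hQH
  set D : Matrix (Fin n) (Fin n) ℂ := Matrix.diagonal fun i => ((lam i : ℂ))⁻¹ with hD
  set Y : Fin n → Matrix (Fin n) (Fin n) ℂ := fun k => Q * X k * Qᴴ with hY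
  set Z : Fin n → Matrix (Fin n) (Fin n) ℂ := fun a => ∑ k, Q a k • Y k with hZ
  have t1 : ∀ k, (G⁻¹ * X k).trace = (Y k).trace := fun k => by
    rw [hGi, Matrix.mul_assoc, Matrix.trace_mul_comm]
  have t2 : ∀ k l, (G⁻¹ * X k * H⁻¹ * (X l)ᴴ).trace = (Y k * D * (Y l)ᴴ).trace := fun k l => by
    rw [hGi, hHi]
    simp only [hY, Matrix.conjTranspose_mul, Matrix.conjTranspose_conjTranspose, Matrix.mul_assoc]
    rw [Matrix.trace_mul_comm]
    simp only [Matrix.mul_assoc]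
  have e1 : ∀ a, ∑ k, ∑ l, Q a k * star (Q a l) * ((Y k).trace * star (Y l).trace)
      = (Complex.normSq (Z a).trace : ℂ) := fun a => by
    have : (Z a).trace = ∑ k, Q a k * (Y k).trace := by
      simp [hZ, Matrix.trace_sum, Matrix.trace_smul]
    rw [← Complex.mul_conj, this, map_sum, Finset.sum_mul_sum]
    refine Finset.sum_congr rfl fun k _ => Finset.sum_congr rfl fun l _ => ?_
    rw [map_mul]
    simp only [Complex.star_def]
    ring
  have e2 : ∀ a, (Z a * D * (Z a)ᴴ).trace
      = ((∑ b, ∑ c, Complex.normSq (Z a b c) * (lam c)⁻¹ : ℝ) : ℂ) := fun a => by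
    rw [Matrix.trace, ofReal_sum]
    refine Finset.sum_congr rfl fun b _ => ?_
    rw [Matrix.diag_apply, Matrix.mul_apply, ofReal_sum]
    refine Finset.sum_congr rfl fun c _ => ?_
    rw [hD, Matrix.mul_diagonal, Matrix.conjTranspose_apply, ofReal_mul, ofReal_inv,
      ← Complex.mul_conj, Complex.star_def]
    ring
  simp only [t1, t2]
  rw [hHi, sum_diagonal_congr_mul, sum_diagonal_congr_mul]
  simp only [sum_sum_mul_star_mul_trace Y]
  have e3 : ∀ a, ((∑ k, Q a k • Y k) * D * (∑ k, Q a k • Y k)ᴴ).trace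
      = ((∑ b, ∑ c, Complex.normSq (Z a b c) * (lam c)⁻¹ : ℝ) : ℂ) := e2
  simp only [e1, e3]
  simp only [← ofReal_inv, ← ofReal_mul, ← ofReal_sum, ofReal_re]
  rw [Finset.mul_sum]
  refine Finset.sum_le_sum fun a _ => ?_
  have := mul_le_mul_of_nonneg_left (normSq_trace_le hlam (Z a)) (inv_nonneg.2 (hlam a).le)
  linarith

/-- The curvature terms in the formula for the Laplacian of `tr_G H`, estimated by a bound for the
bisectional curvature. -/
theorem curvature_inequality (hlam : ∀ i, 0 < lam i) (hQ : IsUnit Q) (hQG : Q * G * Qᴴ = 1)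
    (hQH : Q * H * Qᴴ = Matrix.diagonal fun i => (lam i : ℂ))
    {R : Fin n → Fin n → Matrix (Fin n) (Fin n) ℂ} (hR : ∀ i j k l, R k l i j = R i j k l) {K : ℝ}
    (hK : ∀ Z W : Fin n → ℂ, Z ≠ 0 → W ≠ 0 →
      |(∑ i, ∑ j, ∑ k, ∑ l, R k l i j * Z i * star (Z j) * W k * star (W l)).re|
        ≤ K * ((∑ j, ∑ k, G j k * Z j * star (Z k)).re * (∑ j, ∑ k, G j k * W j * star (W k)).re)) :
    -(K * ((∑ i, lam i) * (∑ i, (lam i)⁻¹) - (n : ℝ) ^ 2))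
      ≤ (∑ k, ∑ l, H⁻¹ l k * (G⁻¹ * R k l * G⁻¹ * H).trace
          - ∑ k, ∑ l, G⁻¹ l k * (G⁻¹ * R k l).trace).re := by
  have hGi : G⁻¹ = Qᴴ * Q := by
    have := inv_eq_of_congr_diagonal (d := fun _ => 1) hQ (by simp) (by simpa using hQG)
    simpa using this
  have hHi := inv_eq_of_congr_diagonal hQ (fun i => by exact_mod_cast (hlam i).ne') hQH
  have hrow : ∀ a, Q a ≠ 0 := fun a ha => by
    have h0 : Q.det = 0 := Matrix.det_eq_zero_of_row_eq_zero a fun j => congrFun ha j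
    exact ((Matrix.isUnit_iff_isUnit_det _).1 hQ).ne_zero h0
  set r : Fin n → Fin n → ℂ := fun a b =>
    ∑ k, ∑ l, Q a k * star (Q a l) * (Q * R k l * Qᴴ) b b with hr
  have hdiag : ∀ (A : Matrix (Fin n) (Fin n) ℂ) b,
      (Q * A * Qᴴ) b b = ∑ i, ∑ j, Q b i * star (Q b j) * A i j := fun A b => by
    simp only [Matrix.mul_apply, Matrix.conjTranspose_apply, Finset.sum_mul]
    rw [Finset.sum_comm]
    exact Finset.sum_congr rfl fun i _ => Finset.sum_congr rfl fun j _ => by ring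
  have hr' : ∀ a b, r a b = ∑ i, ∑ j, ∑ k, ∑ l,
      R k l i j * Q b i * star (Q b j) * Q a k * star (Q a l) := fun a b => by
    simp only [hr, hdiag, Finset.mul_sum]
    calc ∑ k, ∑ l, ∑ i, ∑ j, Q a k * star (Q a l) * (Q b i * star (Q b j) * R k l i j)
        = ∑ x : Fin n × Fin n, ∑ y : Fin n × Fin n,
          Q a x.1 * star (Q a x.2) * (Q b y.1 * star (Q b y.2) * R x.1 x.2 y.1 y.2) := by
          simp only [Fintype.sum_prod_type]
      _ = _ := by
          rw [Finset.sum_comm]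
          simp only [Fintype.sum_prod_type]
          exact Finset.sum_congr rfl fun i _ => Finset.sum_congr rfl fun j _ =>
            Finset.sum_congr rfl fun k _ => Finset.sum_congr rfl fun l _ => by ring
  have hsymm : ∀ a b, r a b = r b a := fun a b => by
    rw [hr' a b]
    simp only [hr, hdiag, Finset.mul_sum]
    refine Finset.sum_congr rfl fun i _ => Finset.sum_congr rfl fun j _ =>
      Finset.sum_congr rfl fun k _ => Finset.sum_congr rfl fun l _ => ?_
    rw [hR i j k l]
    ring
  have hnorm : ∀ a, (∑ j, ∑ k, G j k * Q a j * star (Q a k)).re = 1 := fun a => by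
    have : ∑ j, ∑ k, G j k * Q a j * star (Q a k) = (Q * G * Qᴴ) a a := by
      rw [hdiag]
      exact Finset.sum_congr rfl fun i _ => Finset.sum_congr rfl fun j _ => by ring
    rw [this, hQG]; simp
  have hbound : ∀ a b, |(r a b).re| ≤ K := fun a b => by
    have := hK (Q b) (Q a) (hrow b) (hrow a)
    rw [hnorm, hnorm] at this
    rw [hr']
    simpa using this
  have t1 : ∀ k l, (G⁻¹ * R k l).trace = ∑ b, (Q * R k l * Qᴴ) b b := fun k l => by
    rw [hGi, Matrix.mul_assoc, Matrix.trace_mul_comm]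
    rfl
  have t2 : ∀ k l, (G⁻¹ * R k l * G⁻¹ * H).trace = ∑ b, (lam b : ℂ) * (Q * R k l * Qᴴ) b b :=
    fun k l => by
    have hQd : IsUnit (Qᴴ).det := by
      rw [Matrix.det_conjTranspose]; exact ((Matrix.isUnit_iff_isUnit_det _).1 hQ).star
    have h1 : (G⁻¹ * R k l * G⁻¹ * H).trace
        = (Q * R k l * Qᴴ * (Q * H * Qᴴ) * (Qᴴ)⁻¹ * Qᴴ).trace := by
      rw [Matrix.mul_assoc _ (Qᴴ)⁻¹, Matrix.nonsing_inv_mul _ hQd, Matrix.mul_one, hGi]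
      have := Matrix.trace_mul_comm (Q * R k l * Qᴴ * Q * H) Qᴴ
      simp only [Matrix.mul_assoc] at this ⊢
      exact this.symm
    rw [h1, Matrix.mul_assoc _ (Qᴴ)⁻¹, Matrix.nonsing_inv_mul _ hQd, Matrix.mul_one, hQH,
      trace_mul_diagonal]
    exact Finset.sum_congr rfl fun b _ => mul_comm _ _
  have swap : ∀ (a : Fin n) (c : Fin n → ℂ),
      ∑ k, ∑ l, Q a k * star (Q a l) * ∑ b, c b * (Q * R k l * Qᴴ) b b = ∑ b, c b * r a b := by
    intro a c
    simp only [hr, Finset.mul_sum]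
    rw [Finset.sum_congr rfl fun k _ => Finset.sum_comm, Finset.sum_comm]
    exact Finset.sum_congr rfl fun i _ => Finset.sum_congr rfl fun j _ =>
      Finset.sum_congr rfl fun k _ => by ring
  have s1 : ∑ k, ∑ l, H⁻¹ l k * (G⁻¹ * R k l * G⁻¹ * H).trace
      = ∑ a, ((lam a : ℂ))⁻¹ * ∑ b, (lam b : ℂ) * r a b := by
    simp only [t2]
    rw [hHi, sum_diagonal_congr_mul]
    simp only [swap]
  have s2 : ∑ k, ∑ l, G⁻¹ l k * (G⁻¹ * R k l).trace = ∑ a, ∑ b, r a b := by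
    have := sum_diagonal_congr_mul Q (fun _ => 1) fun k l => (G⁻¹ * R k l).trace
    simp only [Matrix.diagonal_one, Matrix.mul_one, one_mul, ← hGi] at this
    rw [this]
    refine Finset.sum_congr rfl fun a _ => ?_
    have := swap a fun _ => 1
    simp only [one_mul] at this
    simp only [t1, this]
  have := curvature_sum_ge hlam hbound fun a b => by rw [hsymm a b]
  rw [s1, s2]
  convert this using 1
  simp only [← ofReal_inv, sub_re, re_sum, re_ofReal_mul]

theorem trace_inv_mul_eq_sum (hlam : ∀ i, 0 < lam i) (hQ : IsUnit Q) (hQG : Q * G * Qᴴ = 1)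
    (hQH : Q * H * Qᴴ = Matrix.diagonal fun i => (lam i : ℂ)) :
    (G⁻¹ * H).trace = ((∑ i, lam i : ℝ) : ℂ) ∧ (H⁻¹ * G).trace = ((∑ i, (lam i)⁻¹ : ℝ) : ℂ) ∧
      H.det = ((∏ i, lam i : ℝ) : ℂ) * G.det := by
  have hGi : G⁻¹ = Qᴴ * Q := by
    have := inv_eq_of_congr_diagonal (d := fun _ => 1) hQ (by simp) (by simpa using hQG)
    simpa using this
  have hHi := inv_eq_of_congr_diagonal hQ (fun i => by exact_mod_cast (hlam i).ne') hQH
  refine ⟨?_, ?_, ?_⟩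
  · rw [hGi, Matrix.mul_assoc, Matrix.trace_mul_comm, hQH, Matrix.trace_diagonal]
    push_cast; rfl
  · rw [hHi, Matrix.mul_assoc, Matrix.mul_assoc, Matrix.trace_mul_comm, Matrix.mul_assoc, hQG,
      Matrix.mul_one, Matrix.trace_diagonal]
    push_cast; rfl
  · have h1 := congrArg Matrix.det hQG
    have h2 := congrArg Matrix.det hQH
    rw [Matrix.det_mul, Matrix.det_mul, Matrix.det_one] at h1
    rw [Matrix.det_mul, Matrix.det_mul, Matrix.det_diagonal] at h2
    push_cast
    rw [← h2]
    linear_combination -H.det * h1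

end diagonalized

/-- The elementary symmetric polynomial of degree `n - 1` is at most the `(n-1)`-st power of the
sum. -/
theorem sum_prod_erase_le {ι : Type*} [DecidableEq ι] (S : Finset ι) (hS : S.Nonempty) {μ : ι → ℝ}
    (hμ : ∀ i, 0 ≤ μ i) :
    ∑ i ∈ S, ∏ j ∈ S.erase i, μ j ≤ (∑ i ∈ S, μ i) ^ (S.card - 1) := by
  induction hS using Finset.Nonempty.cons_induction with
  | singleton a => simp
  | cons a S ha hS ih =>
    rw [Finset.cons_eq_insert, Finset.sum_insert ha, Finset.sum_insert ha,
      Finset.erase_insert ha, Finset.card_insert_of_notMem ha, Nat.add_sub_cancel]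
    have h1 : ∑ i ∈ S, ∏ j ∈ (insert a S).erase i, μ j = μ a * ∑ i ∈ S, ∏ j ∈ S.erase i, μ j := by
      rw [Finset.mul_sum]
      refine Finset.sum_congr rfl fun i hi => ?_
      rw [Finset.erase_insert_of_ne (by rintro rfl; exact ha hi),
        Finset.prod_insert fun h => ha (Finset.mem_of_mem_erase h)]
    have hs : 0 ≤ ∑ i ∈ S, μ i := Finset.sum_nonneg fun i _ => hμ i
    have h2 : ∏ j ∈ S, μ j ≤ (∑ i ∈ S, μ i) ^ S.card := by
      rw [← Finset.prod_const]
      exact Finset.prod_le_prod (fun j _ => hμ j) fun i hi =>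
        Finset.single_le_sum (fun j _ => hμ j) hi
    obtain ⟨m, hm⟩ : ∃ m, S.card = m + 1 := ⟨S.card - 1, by have := hS.card_pos; omega⟩
    rw [hm, Nat.add_sub_cancel] at ih
    rw [hm] at h2 ⊢
    rw [h1]
    set s := ∑ i ∈ S, μ i
    -- the sum for `insert a S` is `∏_S μ + μₐ` times the sum for `S`
    have h3 : s ^ m ≤ (μ a + s) ^ m := pow_le_pow_left₀ hs (le_add_of_nonneg_left (hμ a)) m
    calc ∏ j ∈ S, μ j + μ a * ∑ i ∈ S, ∏ j ∈ S.erase i, μ j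
        ≤ s ^ (m + 1) + μ a * s ^ m := add_le_add h2 (mul_le_mul_of_nonneg_left ih (hμ a))
      _ = (μ a + s) * s ^ m := by ring
      _ ≤ (μ a + s) * (μ a + s) ^ m :=
          mul_le_mul_of_nonneg_left h3 (add_nonneg (hμ a) hs)
      _ = (μ a + s) ^ (m + 1) := by ring

/-- The sum of the reciprocals is bounded below by a power of the sum, once the product is bounded
above. -/
theorem rpow_le_sum_mul_sum_inv (hn : 2 ≤ n) {lam : Fin n → ℝ} (hlam : ∀ i, 0 < lam i) {F₀ : ℝ}
    (hF : ∏ i, lam i ≤ Real.exp F₀) :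
    Real.exp (-F₀ / ((n : ℝ) - 1)) * (∑ i, lam i) ^ ((n : ℝ) / ((n : ℝ) - 1))
      ≤ (∑ i, lam i) * ∑ i, (lam i)⁻¹ := by
  have hn1 : (0 : ℝ) < (n : ℝ) - 1 := by
    have : (2 : ℝ) ≤ n := by exact_mod_cast hn
    linarith
  have : Nonempty (Fin n) := ⟨⟨0, by omega⟩⟩
  set y := ∑ i, lam i with hy
  set S := ∑ i, (lam i)⁻¹ with hSdef
  have hy0 : 0 < y := Finset.sum_pos (fun i _ => hlam i) Finset.univ_nonempty
  have hS0 : 0 < S := Finset.sum_pos (fun i _ => inv_pos.2 (hlam i)) Finset.univ_nonempty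
  have hP : 0 < ∏ i, lam i := Finset.prod_pos fun i _ => hlam i
  -- `y / ∏ λᵢ` is the elementary symmetric polynomial of degree `n - 1` in the `1/λᵢ`
  have h1 : y * (∏ i, lam i)⁻¹ ≤ S ^ (n - 1) := by
    have h := sum_prod_erase_le (Finset.univ : Finset (Fin n)) Finset.univ_nonempty
      (μ := fun i => (lam i)⁻¹) fun i => (inv_pos.2 (hlam i)).le
    rw [Finset.card_univ, Fintype.card_fin] at h
    refine le_trans (le_of_eq ?_) h
    rw [hy, Finset.sum_mul]
    refine Finset.sum_congr rfl fun i _ => ?_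
    rw [Finset.prod_inv_distrib, ← Finset.mul_prod_erase Finset.univ lam (Finset.mem_univ i)]
    field_simp [(hlam i).ne']
  have h2 : y * Real.exp (-F₀) ≤ S ^ ((n : ℝ) - 1) := by
    have e : (S : ℝ) ^ ((n : ℝ) - 1) = S ^ (n - 1) := by
      rw [← Real.rpow_natCast, Nat.cast_sub (by omega), Nat.cast_one]
    rw [e, Real.exp_neg]
    exact (mul_le_mul_of_nonneg_left (inv_anti₀ hP hF) hy0.le).trans h1
  have h3 : (y * Real.exp (-F₀)) ^ (((n : ℝ) - 1)⁻¹) ≤ S := by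
    have := Real.rpow_le_rpow (by positivity) h2 (inv_pos.2 hn1).le
    rwa [← Real.rpow_mul hS0.le, mul_inv_cancel₀ hn1.ne', Real.rpow_one] at this
  rw [Real.mul_rpow hy0.le (Real.exp_pos _).le, ← Real.exp_mul] at h3
  have e : (n : ℝ) / ((n : ℝ) - 1) = 1 + ((n : ℝ) - 1)⁻¹ := by
    field_simp
    ring
  rw [e, Real.rpow_add hy0, Real.rpow_one, div_eq_mul_inv]
  calc _ = y * (y ^ ((n : ℝ) - 1)⁻¹ * Real.exp (-F₀ * ((n : ℝ) - 1)⁻¹)) := by ring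
    _ ≤ y * S := mul_le_mul_of_nonneg_left h3 hy0.le

/-! ### The inequality in a coordinate domain -/

theorem ContDiffAt.ofReal_comp {E : Type*} [NormedAddCommGroup E] [NormedSpace ℝ E] {m : ℕ∞ω}
    {u : E → ℝ} {z : E} (hu : ContDiffAt ℝ m u z) : ContDiffAt ℝ m (fun x => (u x : ℂ)) z :=
  ofRealCLM.contDiff.contDiffAt.comp z hu

/-- The complex Hessian of a function on `ℂⁿ`. -/
def hessian (u : (Fin n → ℂ) → ℂ) (z : Fin n → ℂ) : Matrix (Fin n) (Fin n) ℂ :=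
  Matrix.of fun j k => wirt (-1) j (wirt 1 k u) z

theorem trace_mul_hessian (A : Matrix (Fin n) (Fin n) ℂ) (u : (Fin n → ℂ) → ℂ) (z : Fin n → ℂ) :
    (A * hessian u z).trace = ∑ k, ∑ l, A l k * wirt (-1) k (wirt 1 l u) z := by
  simp only [Matrix.trace, Matrix.diag_apply, Matrix.mul_apply, hessian, Matrix.of_apply]
  exact Finset.sum_comm

theorem hessian_sub_const_mul {u v : (Fin n → ℂ) → ℂ} {z : Fin n → ℂ} (hu : ContDiffAt ℝ 2 u z)
    (hv : ContDiffAt ℝ 2 v z) (c : ℂ) :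
    hessian (fun x => u x - c * v x) z = hessian u z - c • hessian v z := by
  ext j k
  have hu1 := hu.of_le (m := 1) (by norm_num)
  have hv1 := hv.of_le (m := 1) (by norm_num)
  have e : wirt 1 k (fun x => u x - c * v x) =ᶠ[𝓝 z] fun x => wirt 1 k u x - c * wirt 1 k v x := by
    filter_upwards [hu1.eventually (by simp), hv1.eventually (by simp)] with x h1 h2
    have d1 := h1.differentiableAt (by norm_num)
    have d2 := h2.differentiableAt (by norm_num)
    rw [wirt_sub d1 (d2.const_mul c), wirt_mul (differentiableAt_const c) d2, wirt_const]
    ring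
  have d1 := (hu.wirt (s := 1) (j := k) (m := 1) (by norm_num)).differentiableAt (by norm_num)
  have d2 := (hv.wirt (s := 1) (j := k) (m := 1) (by norm_num)).differentiableAt (by norm_num)
  simp only [hessian, Matrix.of_apply, Matrix.sub_apply, Matrix.smul_apply, smul_eq_mul]
  rw [wirt_congr e, wirt_sub d1 (d2.const_mul c), wirt_mul (differentiableAt_const c) d2,
    wirt_const]
  ring

/-- The estimate for the Laplacian of `log tr_G H - c Φ` with respect to `H = G + ∂∂̄Φ`, at a point
of an open subset of `ℂⁿ`; `ℓ` is the logarithm of `tr_G H`. -/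
theorem laplacian_log_trace_le (hn : 2 ≤ n) {U : Set (Fin n → ℂ)} (hU : IsOpen U)
    {G H : (Fin n → ℂ) → Matrix (Fin n) (Fin n) ℂ} (hG : IsKahlerOn U G) (hH : IsKahlerOn U H)
    {f Φ ℓ : (Fin n → ℂ) → ℝ} (hf : ∀ x ∈ U, ContDiffAt ℝ 2 f x)
    (hΦ : ∀ x ∈ U, ContDiffAt ℝ 2 Φ x) (hℓ : ∀ x ∈ U, ContDiffAt ℝ 2 ℓ x)
    (hdet : ∀ x ∈ U, (H x).det = exp (f x) * (G x).det)
    (hlog : ∀ x ∈ U, exp (ℓ x) = ((G x)⁻¹ * H x).trace)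
    {z : Fin n → ℂ} (hz : z ∈ U) (hHG : H z = G z + hessian (fun x => (Φ x : ℂ)) z)
    {K F₀ F₁ : ℝ} (hf0 : f z ≤ F₀)
    (hf1 : -((G z)⁻¹ * hessian (fun x => (f x : ℂ)) z).trace.re ≤ F₁)
    (hK : ∀ Z W : Fin n → ℂ, Z ≠ 0 → W ≠ 0 →
      |(∑ i, ∑ j, ∑ k, ∑ l,
          matCurv G k l z i j * Z i * star (Z j) * W k * star (W l)).re|
        ≤ K * ((∑ j, ∑ k, G z j k * Z j * star (Z k)).re
          * (∑ j, ∑ k, G z j k * W j * star (W k)).re)) :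
    ((G z)⁻¹ * H z).trace.re
        * -((H z)⁻¹ * hessian (fun x => ((ℓ x - (|K| + 1) * Φ x : ℝ) : ℂ)) z).trace.re
      ≤ (F₁ + |K| * (n : ℝ) ^ 2) + (|K| + 1) * n * ((G z)⁻¹ * H z).trace.re
        - Real.exp (-F₀ / ((n : ℝ) - 1))
          * ((G z)⁻¹ * H z).trace.re ^ ((n : ℝ) / ((n : ℝ) - 1)) := by
  obtain ⟨Q, lam, hlam, hQ, hQG, hQH⟩ :=
    exists_simultaneous_diagonalization (hG.posDef z hz) (hH.posDef z hz)
  obtain ⟨hy, hS, hprod⟩ := trace_inv_mul_eq_sum hlam hQ hQG hQH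
  have : Nonempty (Fin n) := ⟨⟨0, by omega⟩⟩
  set y := ∑ i, lam i with hydef
  set S := ∑ i, (lam i)⁻¹ with hSdef
  have hy0 : 0 < y := Finset.sum_pos (fun i _ => hlam i) Finset.univ_nonempty
  have hS0 : 0 < S := Finset.sum_pos (fun i _ => inv_pos.2 (hlam i)) Finset.univ_nonempty
  set Y : (Fin n → ℂ) → ℂ := fun x => ((G x)⁻¹ * H x).trace with hY
  have hYeq : Set.EqOn (fun x => exp ((ℓ x : ℝ) : ℂ)) Y U := hlog
  have hG1 := (hG.contDiffAt z hz).of_le (m := 1) (by norm_num)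
  have hH1 := (hH.contDiffAt z hz).of_le (m := 1) (by norm_num)
  have hYk : ∀ k, wirt (-1) k Y z = ((G z)⁻¹ * covDeriv G H k z).trace := fun k =>
    wirt_trace_inv_mul hG1 hH1 (hG.isUnit_det hz)
  have hYl : ∀ l, wirt 1 l Y z = star ((G z)⁻¹ * covDeriv G H l z).trace := fun l => by
    rw [← hYk]
    have : Set.EqOn Y (fun x => (starRingEnd ℂ) (Y x)) U := fun x hx => by
      have h := hYeq hx
      simp only at h
      change Y x = (starRingEnd ℂ) (Y x)
      rw [← h, ← exp_conj, conj_ofReal]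
    rw [wirt_congr_of_eqOn hU hz this, wirt_conj]
    simp
  -- the Laplacian of the logarithm in terms of first and second derivatives of the trace
  have hlogk : ∀ k l, (y : ℂ) * wirt (-1) k (wirt 1 l fun x => (ℓ x : ℂ)) z
      = wirt (-1) k (wirt 1 l Y) z - (y : ℂ)⁻¹ * (((G z)⁻¹ * covDeriv G H k z).trace
          * star ((G z)⁻¹ * covDeriv G H l z).trace) := fun k l => by
    have h := exp_mul_wirt_wirt (s := -1) (t := 1) (j := k) (k := l) (hℓ z hz).ofReal_comp
    have e : Set.EqOn (wirt 1 l fun x => exp ((ℓ x : ℝ) : ℂ)) (wirt 1 l Y) U := fun x hx =>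
      wirt_congr_of_eqOn hU hx hYeq
    rw [wirt_congr_of_eqOn hU hz e, wirt_congr_of_eqOn hU hz hYeq, e hz, hYk, hYl, hlog z hz,
      hy] at h
    rw [h]
    ring
  have hsum : (y : ℂ) * ((H z)⁻¹ * hessian (fun x => (ℓ x : ℂ)) z).trace
      = ∑ k, ∑ l, (H z)⁻¹ l k * wirt (-1) k (wirt 1 l Y) z
        - (y : ℂ)⁻¹ * ∑ k, ∑ l, (H z)⁻¹ l k * (((G z)⁻¹ * covDeriv G H k z).trace
          * star ((G z)⁻¹ * covDeriv G H l z).trace) := by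
    rw [trace_mul_hessian]
    simp only [Finset.mul_sum, ← Finset.sum_sub_distrib]
    refine Finset.sum_congr rfl fun k _ => Finset.sum_congr rfl fun l _ => ?_
    linear_combination (H z)⁻¹ l k * hlogk k l
  have hmain := hG.sum_inv_mul_wirt_wirt_trace hH hU hz
    (F := fun x => (f x : ℂ)) (fun x hx => (hf x hx).ofReal_comp) hdet
  have hgrad := gradient_inequality hlam hQ hQG hQH fun k => covDeriv G H k z
  have hcurv := curvature_inequality hlam hQ hQG hQH
    (R := fun k l => matCurv G k l z) (fun i j k l => hG.matCurv_symm hU hz i j k l) hK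
  rw [← hydef, ← hSdef] at hcurv
  rw [← hydef] at hgrad
  rw [trace_mul_hessian] at hf1
  -- the Laplacian of `Φ` is `n - S`, as `∂∂̄Φ = H - G` at the point
  have hΦS : ((H z)⁻¹ * hessian (fun x => (Φ x : ℂ)) z).trace = n - (S : ℂ) := by
    rw [← hS, eq_sub_iff_add_eq, ← Matrix.trace_add, ← mul_add, add_comm (hessian _ _), ← hHG,
      Matrix.nonsing_inv_mul _ (hH.isUnit_det hz), Matrix.trace_one, Fintype.card_fin]
  have hhess : ((H z)⁻¹ * hessian (fun x => ((ℓ x - (|K| + 1) * Φ x : ℝ) : ℂ)) z).trace.re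
      = ((H z)⁻¹ * hessian (fun x => (ℓ x : ℂ)) z).trace.re - (|K| + 1) * (n - S) := by
    have h := hessian_sub_const_mul (hℓ z hz).ofReal_comp (hΦ z hz).ofReal_comp ((|K| + 1 : ℝ) : ℂ)
    have e : (fun x => ((ℓ x - (|K| + 1) * Φ x : ℝ) : ℂ))
        = fun x => (ℓ x : ℂ) - ((|K| + 1 : ℝ) : ℂ) * (Φ x : ℂ) := by
      funext x; push_cast; ring
    rw [e, h, mul_sub, Matrix.trace_sub, Matrix.mul_smul, Matrix.trace_smul, hΦS, sub_re,
      smul_eq_mul, re_ofReal_mul, sub_re, natCast_re, ofReal_re]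
  have hre := congrArg Complex.re hsum
  rw [hmain] at hre
  rw [← ofReal_inv, sub_re, re_ofReal_mul, re_ofReal_mul, add_re, add_re] at hre
  have hprodF : ∏ i, lam i ≤ Real.exp F₀ := by
    have h := hdet z hz
    rw [hprod] at h
    have h' := mul_right_cancel₀ (hG.isUnit_det hz).ne_zero h
    rw [← ofReal_exp] at h'
    rw [ofReal_injective h']
    exact Real.exp_le_exp.2 hf0
  have hpow := rpow_le_sum_mul_sum_inv hn hlam hprodF
  rw [← hydef, ← hSdef] at hpow
  have hgrad' := mul_le_mul_of_nonneg_left hgrad (inv_nonneg.2 hy0.le)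
  rw [← mul_assoc, inv_mul_cancel₀ hy0.ne', one_mul] at hgrad'
  rw [hhess, hy, ofReal_re]
  have hKK : K * (y * S - (n : ℝ) ^ 2) ≤ |K| * (y * S) + |K| * (n : ℝ) ^ 2 := by
    have h1 : K * (y * S) ≤ |K| * (y * S) :=
      mul_le_mul_of_nonneg_right (le_abs_self K) (mul_pos hy0 hS0).le
    have h2 : -K * (n : ℝ) ^ 2 ≤ |K| * (n : ℝ) ^ 2 :=
      mul_le_mul_of_nonneg_right (neg_le_abs K) (sq_nonneg _)
    linarith
  linarith

/-! ### Holomorphic changes of coordinates -/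

/-- The complex Jacobian matrix `(∂τᵃ/∂zʲ)_{j,a}` of a map between open subsets of `ℂⁿ`. -/
def jac (τ : (Fin n → ℂ) → (Fin n → ℂ)) (z : Fin n → ℂ) : Matrix (Fin n) (Fin n) ℂ :=
  Matrix.of fun j a => fderiv ℂ τ z (Pi.single j 1) a

theorem MatContDiffAt.conjTranspose {m : ℕ∞ω} {A : (Fin n → ℂ) → Matrix (Fin n) (Fin n) ℂ}
    {z : Fin n → ℂ} (hA : MatContDiffAt m A z) : MatContDiffAt m (fun x => (A x)ᴴ) z :=
  fun a b => conjCLE.contDiff.contDiffAt.comp z (hA b a)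

theorem wirtM_zero_fun {s : ℂ} {j : Fin n} {z : Fin n → ℂ} :
    wirtM s j (fun _ => (0 : Matrix (Fin n) (Fin n) ℂ)) z = 0 := by
  ext a b
  exact wirt_const 0

section holomorphic

variable {V : Set (Fin n → ℂ)} {τ : (Fin n → ℂ) → (Fin n → ℂ)} {z : Fin n → ℂ}

theorem contDiffAt_jac (hV : IsOpen V) (hτ : ContDiffOn ℂ ω τ V) (hz : z ∈ V) (j a : Fin n) :
    ContDiffAt ℂ ω (fun x => jac τ x j a) z := by
  have h1 : ContDiffAt ℂ ω τ z := hτ.contDiffAt (hV.mem_nhds hz)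
  have h2 : ContDiffAt ℂ ω (fun x => fderiv ℂ τ x (Pi.single j 1)) z :=
    (h1.fderiv_right (m := ω) le_rfl).clm_apply contDiffAt_const
  exact contDiffAt_pi.1 h2 a

theorem matContDiffAt_jac (hV : IsOpen V) (hτ : ContDiffOn ℂ ω τ V) (hz : z ∈ V) (m : ℕ∞ω) :
    MatContDiffAt m (jac τ) z :=
  fun j a => ((contDiffAt_jac hV hτ hz j a).restrict_scalars ℝ).of_le le_top

theorem wirtM_one_jac (hV : IsOpen V) (hτ : ContDiffOn ℂ ω τ V) (hz : z ∈ V) (l : Fin n) :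
    wirtM 1 l (jac τ) z = 0 := by
  ext j a
  have := dzbar_holomorphic ((contDiffAt_jac hV hτ hz j a).differentiableAt (by simp)) l
  rwa [dzbar_eq_wirt] at this

theorem differentiableAt_of_contDiffOn (hV : IsOpen V) (hτ : ContDiffOn ℂ ω τ V) (hz : z ∈ V) :
    DifferentiableAt ℂ τ z :=
  (hτ.contDiffAt (hV.mem_nhds hz)).differentiableAt (by simp)

theorem contDiffAt_comp_holomorphic (hV : IsOpen V) (hτ : ContDiffOn ℂ ω τ V) (hz : z ∈ V)
    {m : ℕ∞ω} {v : (Fin n → ℂ) → ℂ} (hv : ContDiffAt ℝ m v (τ z)) :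
    ContDiffAt ℝ m (fun x => v (τ x)) z :=
  hv.comp z (((hτ.contDiffAt (hV.mem_nhds hz)).restrict_scalars ℝ).of_le le_top)

/-- The complex Hessian is a tensor: the second derivatives of the holomorphic map `τ` do not enter,
as `∂_j` annihilates the conjugate of its Jacobian. -/
theorem hessian_comp (hV : IsOpen V) (hτ : ContDiffOn ℂ ω τ V) (hz : z ∈ V)
    {v : (Fin n → ℂ) → ℂ} (hv : ∀ x ∈ V, ContDiffAt ℝ 2 v (τ x)) :
    hessian (fun x => v (τ x)) z = jac τ z * hessian v (τ z) * (jac τ z)ᴴ := by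
  ext j k
  have e : Set.EqOn (wirt 1 k fun x => v (τ x))
      (fun x => ∑ a, (jac τ x)ᴴ a k * wirt 1 a v (τ x)) V := fun x hx => by
    have h := dzbar_comp_holomorphic ((hv x hx).differentiableAt (by norm_num))
      (differentiableAt_of_contDiffOn hV hτ hx) k
    rw [dzbar_eq_wirt] at h
    exact h
  have hw : ∀ a, ContDiffAt ℝ 1 (wirt 1 a v) (τ z) := fun a => (hv z hz).wirt (by norm_num)
  have hJ : ∀ a, DifferentiableAt ℝ (fun x => (jac τ x)ᴴ a k) z := fun a =>
    (matContDiffAt_jac hV hτ hz 1).conjTranspose.differentiableAt le_rfl a k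
  have hwτ : ∀ a, DifferentiableAt ℝ (fun x => wirt 1 a v (τ x)) z := fun a =>
    (contDiffAt_comp_holomorphic hV hτ hz (hw a)).differentiableAt (by norm_num)
  have hJ0 : ∀ a, wirt (-1) j (fun x => (jac τ x)ᴴ a k) z = 0 := fun a => by
    have h : wirtM (-1) j (fun x => (jac τ x)ᴴ) z = 0 := by
      rw [wirtM_conjTranspose, map_neg, map_one, neg_neg, wirtM_one_jac hV hτ hz,
        Matrix.conjTranspose_zero]
    exact congrFun (congrFun h a) k
  have hchain : ∀ a, wirt (-1) j (fun x => wirt 1 a v (τ x)) z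
      = ∑ b, jac τ z j b * wirt (-1) b (wirt 1 a v) (τ z) := fun a => by
    have h := dz_comp_holomorphic ((hw a).differentiableAt (by norm_num))
      (differentiableAt_of_contDiffOn hV hτ hz) j
    rw [dz_eq_wirt] at h
    exact h
  calc wirt (-1) j (wirt 1 k fun x => v (τ x)) z
      = ∑ a, (jac τ z)ᴴ a k * ∑ b, jac τ z j b * wirt (-1) b (wirt 1 a v) (τ z) := by
        rw [wirt_congr_of_eqOn hV hz e, wirt_sum _ fun a _ => (hJ a).fun_mul (hwτ a)]
        refine Finset.sum_congr rfl fun a _ => ?_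
        rw [wirt_mul (hJ a) (hwτ a), hJ0, zero_mul, zero_add, hchain]
    _ = _ := by
        rw [Matrix.mul_apply]
        refine Finset.sum_congr rfl fun a _ => ?_
        rw [Matrix.mul_apply, mul_comm]
        rfl

theorem wirtM_comp (hV : IsOpen V) (hτ : ContDiffOn ℂ ω τ V) (hz : z ∈ V)
    {P : (Fin n → ℂ) → Matrix (Fin n) (Fin n) ℂ} (hP : MatContDiffAt 1 P (τ z)) (k : Fin n) :
    wirtM (-1) k (fun x => P (τ x)) z = ∑ c, jac τ z k c • wirtM (-1) c P (τ z) := by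
  ext i j
  have h := dz_comp_holomorphic (hP.differentiableAt le_rfl i j)
    (differentiableAt_of_contDiffOn hV hτ hz) k
  rw [dz_eq_wirt] at h
  simp only [Matrix.sum_apply, Matrix.smul_apply, smul_eq_mul]
  exact h

theorem wirtM_one_comp (hV : IsOpen V) (hτ : ContDiffOn ℂ ω τ V) (hz : z ∈ V)
    {P : (Fin n → ℂ) → Matrix (Fin n) (Fin n) ℂ} (hP : MatContDiffAt 1 P (τ z)) (l : Fin n) :
    wirtM 1 l (fun x => P (τ x)) z = ∑ d, star (jac τ z l d) • wirtM 1 d P (τ z) := by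
  ext i j
  have h := dzbar_comp_holomorphic (hP.differentiableAt le_rfl i j)
    (differentiableAt_of_contDiffOn hV hτ hz) l
  rw [dzbar_eq_wirt] at h
  simp only [Matrix.sum_apply, Matrix.smul_apply, smul_eq_mul]
  exact h

/-- The curvature of `P ∘ τ` for a holomorphic map `τ`; only the two differentiated indices are
transformed. -/
theorem matCurv_comp (hV : IsOpen V) (hτ : ContDiffOn ℂ ω τ V) (hz : z ∈ V)
    {P : (Fin n → ℂ) → Matrix (Fin n) (Fin n) ℂ} (hP : ∀ x ∈ V, MatContDiffAt 2 P (τ x))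
    (k l : Fin n) :
    matCurv (fun x => P (τ x)) k l z
      = ∑ c, ∑ d, (jac τ z k c * star (jac τ z l d)) • matCurv P c d (τ z) := by
  have hP1 := (hP z hz).of_le (m := 1) (by norm_num)
  have h2 : wirtM (-1) k (wirtM 1 l fun x => P (τ x)) z
      = ∑ c, ∑ d, (jac τ z k c * star (jac τ z l d)) • wirtM (-1) c (wirtM 1 d P) (τ z) := by
    ext i j
    have h := congrFun (congrFun (hessian_comp hV hτ hz fun x hx => hP x hx i j) k) l
    refine Eq.trans h ?_
    simp only [Matrix.mul_apply, Matrix.sum_apply, Matrix.smul_apply, Finset.sum_mul, smul_eq_mul,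
      Matrix.conjTranspose_apply]
    rw [Finset.sum_comm]
    refine Finset.sum_congr rfl fun c _ => Finset.sum_congr rfl fun d _ => ?_
    simp only [hessian, wirtM, Matrix.of_apply]
    ring
  have h1 : (∑ c, jac τ z k c • wirtM (-1) c P (τ z)) * (P (τ z))⁻¹
        * ∑ d, star (jac τ z l d) • wirtM 1 d P (τ z)
      = ∑ c, ∑ d, (jac τ z k c * star (jac τ z l d))
        • (wirtM (-1) c P (τ z) * (P (τ z))⁻¹ * wirtM 1 d P (τ z)) := by
    simp only [Finset.sum_mul, Finset.mul_sum]
    rw [Finset.sum_comm]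
    refine Finset.sum_congr rfl fun c _ => Finset.sum_congr rfl fun d _ => ?_
    rw [Matrix.smul_mul, Matrix.smul_mul, Matrix.mul_smul, smul_smul]
  rw [matCurv, h2, wirtM_comp hV hτ hz hP1, wirtM_one_comp hV hτ hz hP1, h1]
  simp only [matCurv, smul_sub, Finset.sum_sub_distrib]

/-- The curvature is unchanged, up to congruence, under a holomorphic change of frame. -/
theorem matCurv_congr_mul (hV : IsOpen V) (hz : z ∈ V)
    {J P : (Fin n → ℂ) → Matrix (Fin n) (Fin n) ℂ} (hJ : ∀ x ∈ V, MatContDiffAt 2 J x)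
    (hJ0 : ∀ x ∈ V, ∀ l, wirtM 1 l J x = 0) (hP : ∀ x ∈ V, MatContDiffAt 2 P x)
    (hJu : IsUnit (J z).det) (hPu : IsUnit (P z).det) (k l : Fin n) :
    matCurv (fun x => J x * P x * (J x)ᴴ) k l z = J z * matCurv P k l z * (J z)ᴴ := by
  have hl : ∀ x ∈ V, ∀ l, wirtM 1 l (fun x => J x * P x * (J x)ᴴ) x
      = J x * wirtM 1 l P x * (J x)ᴴ + J x * P x * (wirtM (-1) l J x)ᴴ := fun x hx l => by
    have hJ1 := (hJ x hx).of_le (m := 1) (by norm_num)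
    have hP1 := (hP x hx).of_le (m := 1) (by norm_num)
    rw [wirtM_mul (hJ1.mul hP1) hJ1.conjTranspose, wirtM_mul hJ1 hP1, hJ0 x hx, zero_mul, zero_add,
      wirtM_conjTranspose, map_one]
  have hJ1 := (hJ z hz).of_le (m := 1) (by norm_num)
  have hP1 := (hP z hz).of_le (m := 1) (by norm_num)
  have hPl : MatContDiffAt 1 (wirtM 1 l P) z := (hP z hz).wirtM (by norm_num)
  have hJl : MatContDiffAt 1 (wirtM (-1) l J) z := (hJ z hz).wirtM (by norm_num)
  have hJs : wirtM (-1) k (fun x => (J x)ᴴ) z = 0 := by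
    rw [wirtM_conjTranspose, map_neg, map_one, neg_neg, hJ0 z hz, Matrix.conjTranspose_zero]
  have hJls : wirtM (-1) k (fun x => (wirtM (-1) l J x)ᴴ) z = 0 := by
    rw [wirtM_conjTranspose, map_neg, map_one, neg_neg, wirtM_comm (hJ z hz),
      wirtM_congr_of_eqOn hV hz fun x hx => hJ0 x hx k, wirtM_zero_fun, Matrix.conjTranspose_zero]
  have hk : wirtM (-1) k (fun x => J x * P x * (J x)ᴴ) z
      = (wirtM (-1) k J z * P z + J z * wirtM (-1) k P z) * (J z)ᴴ := by
    rw [wirtM_mul (hJ1.mul hP1) hJ1.conjTranspose, wirtM_mul hJ1 hP1, hJs, mul_zero, add_zero]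
  have hkl : wirtM (-1) k (wirtM 1 l fun x => J x * P x * (J x)ᴴ) z
      = (wirtM (-1) k J z * wirtM 1 l P z + J z * wirtM (-1) k (wirtM 1 l P) z) * (J z)ᴴ
        + (wirtM (-1) k J z * P z + J z * wirtM (-1) k P z) * (wirtM (-1) l J z)ᴴ := by
    rw [wirtM_congr_of_eqOn hV hz fun x hx => hl x hx l,
      wirtM_add ((hJ1.mul hPl).mul hJ1.conjTranspose) ((hJ1.mul hP1).mul hJl.conjTranspose),
      wirtM_mul (hJ1.mul hPl) hJ1.conjTranspose, wirtM_mul (hJ1.mul hP1) hJl.conjTranspose,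
      wirtM_mul hJ1 hPl, wirtM_mul hJ1 hP1, hJs, hJls, mul_zero, mul_zero, add_zero, add_zero]
  have hJu' : IsUnit ((J z)ᴴ).det := by rw [Matrix.det_conjTranspose]; exact hJu.star
  have hinv : (J z * P z * (J z)ᴴ)⁻¹ = ((J z)ᴴ)⁻¹ * (P z)⁻¹ * (J z)⁻¹ := by
    rw [Matrix.mul_inv_rev, Matrix.mul_inv_rev, Matrix.mul_assoc]
  have a1 : ∀ X, (J z)ᴴ * (((J z)ᴴ)⁻¹ * X) = X := fun X => by
    rw [← Matrix.mul_assoc, Matrix.mul_nonsing_inv _ hJu', Matrix.one_mul]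
  have a2 : ∀ X, (J z)⁻¹ * (J z * X) = X := fun X => by
    rw [← Matrix.mul_assoc, Matrix.nonsing_inv_mul _ hJu, Matrix.one_mul]
  have a3 : ∀ X, (P z)⁻¹ * (P z * X) = X := fun X => by
    rw [← Matrix.mul_assoc, Matrix.nonsing_inv_mul _ hPu, Matrix.one_mul]
  have a4 : ∀ X, P z * ((P z)⁻¹ * X) = X := fun X => by
    rw [← Matrix.mul_assoc, Matrix.mul_nonsing_inv _ hPu, Matrix.one_mul]
  simp only [matCurv]
  rw [hkl, hk, hl z hz l, hinv]
  simp only [mul_sub, sub_mul, mul_add, add_mul, Matrix.mul_assoc, a1, a2, a3, a4]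
  abel

end holomorphic

/-! ### The bisectional curvature in coordinates -/

/-- The numerator `R(Z, Z̄, W, W̄)` of the bisectional curvature of `H`. -/
def curvForm (H : (Fin n → ℂ) → Matrix (Fin n) (Fin n) ℂ) (z Z W : Fin n → ℂ) : ℂ :=
  ∑ i, ∑ j, ∑ k, ∑ l, matCurv H k l z i j * Z i * star (Z j) * W k * star (W l)

/-- The quadratic form `∑ A_{jk̄} Zʲ Z̄ᵏ`. -/
def sesq (A : Matrix (Fin n) (Fin n) ℂ) (Z : Fin n → ℂ) : ℂ :=
  ∑ j, ∑ k, A j k * Z j * star (Z k)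

theorem sesq_eq_dotProduct (A : Matrix (Fin n) (Fin n) ℂ) (Z : Fin n → ℂ) :
    sesq A Z = Z ⬝ᵥ A *ᵥ star Z := by
  simp only [sesq, dotProduct, Matrix.mulVec, Finset.mul_sum, Pi.star_apply]
  exact Finset.sum_congr rfl fun j _ => Finset.sum_congr rfl fun k _ => by ring

theorem sesq_congr_mul (J A : Matrix (Fin n) (Fin n) ℂ) (Z : Fin n → ℂ) :
    sesq (J * A * Jᴴ) Z = sesq A (Z ᵥ* J) := by
  rw [sesq_eq_dotProduct, sesq_eq_dotProduct, Matrix.star_vecMul, ← Matrix.mulVec_mulVec,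
    ← Matrix.mulVec_mulVec, Matrix.dotProduct_mulVec Z J]

theorem sesq_sum_smul {ι : Type*} (S : Finset ι) (c : ι → ℂ)
    (A : ι → Matrix (Fin n) (Fin n) ℂ) (Z : Fin n → ℂ) :
    sesq (∑ a ∈ S, c a • A a) Z = ∑ a ∈ S, c a * sesq (A a) Z := by
  simp only [sesq_eq_dotProduct, Matrix.sum_mulVec, Matrix.smul_mulVec, dotProduct_sum,
    dotProduct_smul, smul_eq_mul]

theorem curvForm_eq_sum_sesq (H : (Fin n → ℂ) → Matrix (Fin n) (Fin n) ℂ) (z Z W : Fin n → ℂ) :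
    curvForm H z Z W = ∑ k, ∑ l, W k * star (W l) * sesq (matCurv H k l z) Z := by
  simp only [curvForm, sesq, Finset.mul_sum]
  calc _ = ∑ x : Fin n × Fin n, ∑ y : Fin n × Fin n,
        matCurv H y.1 y.2 z x.1 x.2 * Z x.1 * star (Z x.2) * W y.1 * star (W y.2) := by
        simp only [Fintype.sum_prod_type]
    _ = _ := by
        rw [Finset.sum_comm]
        simp only [Fintype.sum_prod_type]
        exact Finset.sum_congr rfl fun k _ => Finset.sum_congr rfl fun l _ =>
          Finset.sum_congr rfl fun i _ => Finset.sum_congr rfl fun j _ => by ring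

/-- The ratio defining the bisectional curvature of `H`. -/
def bisec (H : (Fin n → ℂ) → Matrix (Fin n) (Fin n) ℂ) (z Z W : Fin n → ℂ) : ℝ :=
  (curvForm H z Z W).re / ((sesq (H z) Z).re * (sesq (H z) W).re)

theorem curvForm_change {V : Set (Fin n → ℂ)} {τ : (Fin n → ℂ) → (Fin n → ℂ)} {z : Fin n → ℂ}
    (hV : IsOpen V) (hτ : ContDiffOn ℂ ω τ V) (hz : z ∈ V)
    {G P : (Fin n → ℂ) → Matrix (Fin n) (Fin n) ℂ} (hP : ∀ x ∈ V, MatContDiffAt 2 P (τ x))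
    (hPu : IsUnit (P (τ z)).det) (hJu : IsUnit (jac τ z).det)
    (hG : ∀ x ∈ V, G x = jac τ x * P (τ x) * (jac τ x)ᴴ) (Z W : Fin n → ℂ) :
    curvForm G z Z W = curvForm P (τ z) (Z ᵥ* jac τ z) (W ᵥ* jac τ z) := by
  have hcomp : ∀ x ∈ V, MatContDiffAt 2 (fun y => P (τ y)) x := fun x hx a b =>
    contDiffAt_comp_holomorphic hV hτ hx (hP x hx a b)
  have hcurv : ∀ k l, matCurv G k l z = jac τ z * (∑ x : Fin n × Fin n,
      (jac τ z k x.1 * star (jac τ z l x.2)) • matCurv P x.1 x.2 (τ z)) * (jac τ z)ᴴ := by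
    intro k l
    rw [Fintype.sum_prod_type, ← matCurv_comp hV hτ hz hP,
      ← matCurv_congr_mul hV hz (fun x hx => matContDiffAt_jac hV hτ hx 2)
        (fun x hx => wirtM_one_jac hV hτ hx) hcomp hJu hPu]
    have e : ∀ x ∈ V, wirtM 1 l G x
        = wirtM 1 l (fun y => jac τ y * P (τ y) * (jac τ y)ᴴ) x := fun x hx =>
      wirtM_congr_of_eqOn hV hx hG
    rw [matCurv, matCurv, wirtM_congr_of_eqOn hV hz e, e z hz, wirtM_congr_of_eqOn hV hz hG,
      hG z hz]
  have hs : ∀ k l, sesq (matCurv G k l z) Z = ∑ x : Fin n × Fin n,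
      (jac τ z k x.1 * star (jac τ z l x.2)) * sesq (matCurv P x.1 x.2 (τ z)) (Z ᵥ* jac τ z) := by
    intro k l
    rw [hcurv, sesq_congr_mul, sesq_sum_smul]
  rw [curvForm_eq_sum_sesq, curvForm_eq_sum_sesq]
  simp only [hs]
  have hW : ∀ c, (W ᵥ* jac τ z) c = ∑ k, W k * jac τ z k c := fun c => rfl
  calc _ = ∑ x : Fin n × Fin n, ∑ y : Fin n × Fin n, W y.1 * star (W y.2) *
        ((jac τ z y.1 x.1 * star (jac τ z y.2 x.2))
          * sesq (matCurv P x.1 x.2 (τ z)) (Z ᵥ* jac τ z)) := by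
        symm
        rw [Finset.sum_comm]
        simp only [Fintype.sum_prod_type, Finset.mul_sum]
    _ = _ := by
        rw [Fintype.sum_prod_type]
        refine Finset.sum_congr rfl fun c _ => Finset.sum_congr rfl fun d _ => ?_
        rw [hW, hW, star_sum, Finset.sum_mul_sum, Finset.sum_mul, Fintype.sum_prod_type]
        refine Finset.sum_congr rfl fun k _ => ?_
        rw [Finset.sum_mul]
        refine Finset.sum_congr rfl fun l _ => ?_
        rw [star_mul']
        ring

theorem bisec_change {V : Set (Fin n → ℂ)} {τ : (Fin n → ℂ) → (Fin n → ℂ)} {z : Fin n → ℂ}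
    (hV : IsOpen V) (hτ : ContDiffOn ℂ ω τ V) (hz : z ∈ V)
    {G P : (Fin n → ℂ) → Matrix (Fin n) (Fin n) ℂ} (hP : ∀ x ∈ V, MatContDiffAt 2 P (τ x))
    (hPu : IsUnit (P (τ z)).det) (hJu : IsUnit (jac τ z).det)
    (hG : ∀ x ∈ V, G x = jac τ x * P (τ x) * (jac τ x)ᴴ) (Z W : Fin n → ℂ) :
    bisec G z Z W = bisec P (τ z) (Z ᵥ* jac τ z) (W ᵥ* jac τ z) := by
  rw [bisec, bisec, curvForm_change hV hτ hz hP hPu hJu hG, hG z hz, sesq_congr_mul,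
    sesq_congr_mul]

theorem sesq_re_pos {A : Matrix (Fin n) (Fin n) ℂ} (hA : A.PosDef) {Z : Fin n → ℂ} (hZ : Z ≠ 0) :
    0 < (sesq A Z).re := by
  have h := hA.re_dotProduct_pos (x := star Z) (by simpa using hZ)
  rw [star_star] at h
  rw [sesq_eq_dotProduct]
  exact h

theorem bisec_smul (H : (Fin n → ℂ) → Matrix (Fin n) (Fin n) ℂ) (z Z W : Fin n → ℂ) {a b : ℝ}
    (ha : a ≠ 0) (hb : b ≠ 0) : bisec H z (a • Z) (b • W) = bisec H z Z W := by
  have h1 : curvForm H z (a • Z) (b • W) = ((a ^ 2 * b ^ 2 : ℝ) : ℂ) * curvForm H z Z W := by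
    simp only [curvForm, Finset.mul_sum, Pi.smul_apply, real_smul, Complex.star_def, map_mul,
      conj_ofReal]
    push_cast
    exact Finset.sum_congr rfl fun i _ => Finset.sum_congr rfl fun j _ =>
      Finset.sum_congr rfl fun k _ => Finset.sum_congr rfl fun l _ => by ring
  have h2 : ∀ (c : ℝ) X, sesq (H z) (c • X) = ((c ^ 2 : ℝ) : ℂ) * sesq (H z) X := fun c X => by
    simp only [sesq, Finset.mul_sum, Pi.smul_apply, real_smul, Complex.star_def, map_mul,
      conj_ofReal]
    push_cast
    exact Finset.sum_congr rfl fun i _ => Finset.sum_congr rfl fun j _ => by ring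
  rw [bisec, bisec, h1, h2, h2, re_ofReal_mul, re_ofReal_mul, re_ofReal_mul,
    show a ^ 2 * (sesq (H z) Z).re * (b ^ 2 * (sesq (H z) W).re)
      = a ^ 2 * b ^ 2 * ((sesq (H z) Z).re * (sesq (H z) W).re) by ring,
    mul_div_mul_left _ _ (by positivity)]

/-- The entries of the curvature of a metric of class `C²` are continuous. -/
theorem continuousAt_matCurv {H : (Fin n → ℂ) → Matrix (Fin n) (Fin n) ℂ} {z : Fin n → ℂ}
    (hH : MatContDiffAt 2 H z) (hu : IsUnit (H z).det) (k l i j : Fin n) :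
    ContinuousAt (fun x => matCurv H k l x i j) z := by
  have h1 : MatContDiffAt 0 (fun x => wirtM (-1) k H x * (H x)⁻¹ * wirtM 1 l H x) z :=
    (((hH.wirtM (m := 1) (by norm_num)).mul
      ((hH.of_le (by norm_num)).inv hu)).mul (hH.wirtM (m := 1) (by norm_num))).of_le (by simp)
  have h2 : MatContDiffAt 0 (wirtM (-1) k (wirtM 1 l H)) z :=
    (hH.wirtM (m := 1) (by norm_num)).wirtM (by norm_num)
  exact (h1 i j).continuousAt.sub (h2 i j).continuousAt

/-- The bisectional curvature is homogeneous of degree zero in both vectors and continuous on a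
compact set times two unit spheres, hence bounded over that compact set. -/
theorem IsKahlerOn.exists_bisec_le {U : Set (Fin n → ℂ)}
    {H : (Fin n → ℂ) → Matrix (Fin n) (Fin n) ℂ} (hH : IsKahlerOn U H) {C : Set (Fin n → ℂ)}
    (hC : IsCompact C) (hCU : C ⊆ U) :
    ∃ B : ℝ, ∀ z ∈ C, ∀ Z W : Fin n → ℂ, Z ≠ 0 → W ≠ 0 → |bisec H z Z W| ≤ B := by
  set S : Set (Fin n → ℂ) := Metric.sphere 0 1
  have hS0 : ∀ Z ∈ S, Z ≠ 0 := fun Z hZ h => by simp [S, h] at hZ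
  have hcont : ContinuousOn (fun x : (Fin n → ℂ) × (Fin n → ℂ) × (Fin n → ℂ) =>
      |bisec H x.1 x.2.1 x.2.2|) (C ×ˢ S ×ˢ S) := by
    rintro ⟨z, Z, W⟩ ⟨hz, hZ, hW⟩
    apply ContinuousAt.continuousWithinAt
    have hent : ∀ j k, ContinuousAt
        (fun x : (Fin n → ℂ) × (Fin n → ℂ) × (Fin n → ℂ) => H x.1 j k) (z, Z, W) := fun j k =>
      ContinuousAt.comp (g := fun y => H y j k) (x := (z, Z, W))
        (hH.contDiffAt z (hCU hz) j k).continuousAt continuousAt_fst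
    have hcurv : ∀ k l i j, ContinuousAt
        (fun x : (Fin n → ℂ) × (Fin n → ℂ) × (Fin n → ℂ) => matCurv H k l x.1 i j) (z, Z, W) :=
      fun k l i j => ContinuousAt.comp (g := fun y => matCurv H k l y i j) (x := (z, Z, W))
        (continuousAt_matCurv (hH.contDiffAt z (hCU hz)) (hH.isUnit_det (hCU hz)) k l i j)
        continuousAt_fst
    have hZc : ∀ i, ContinuousAt (fun x : (Fin n → ℂ) × (Fin n → ℂ) × (Fin n → ℂ) => x.2.1 i)
        (z, Z, W) := fun i => by fun_prop
    have hWc : ∀ i, ContinuousAt (fun x : (Fin n → ℂ) × (Fin n → ℂ) × (Fin n → ℂ) => x.2.2 i)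
        (z, Z, W) := fun i => by fun_prop
    have c1 : ContinuousAt (fun x : (Fin n → ℂ) × (Fin n → ℂ) × (Fin n → ℂ) =>
        curvForm H x.1 x.2.1 x.2.2) (z, Z, W) := by
      simp only [curvForm]
      exact tendsto_finsetSum _ fun i _ => tendsto_finsetSum _ fun j _ =>
        tendsto_finsetSum _ fun k _ => tendsto_finsetSum _ fun l _ =>
          ((((hcurv k l i j).mul (hZc i)).mul (hZc j).star).mul (hWc k)).mul (hWc l).star
    have c2 : ContinuousAt (fun x : (Fin n → ℂ) × (Fin n → ℂ) × (Fin n → ℂ) =>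
        sesq (H x.1) x.2.1) (z, Z, W) := by
      simp only [sesq]
      exact tendsto_finsetSum _ fun j _ => tendsto_finsetSum _ fun k _ =>
        ((hent j k).mul (hZc j)).mul (hZc k).star
    have c3 : ContinuousAt (fun x : (Fin n → ℂ) × (Fin n → ℂ) × (Fin n → ℂ) =>
        sesq (H x.1) x.2.2) (z, Z, W) := by
      simp only [sesq]
      exact tendsto_finsetSum _ fun j _ => tendsto_finsetSum _ fun k _ =>
        ((hent j k).mul (hWc j)).mul (hWc k).star
    have hpd := hH.posDef z (hCU hz)
    exact ((continuous_re.continuousAt.comp' c1).div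
      ((continuous_re.continuousAt.comp' c2).mul (continuous_re.continuousAt.comp' c3))
      (mul_pos (sesq_re_pos hpd (hS0 Z hZ)) (sesq_re_pos hpd (hS0 W hW))).ne').abs
  obtain ⟨B, hB⟩ := (hC.prod ((isCompact_sphere 0 1).prod (isCompact_sphere 0 1))).bddAbove_image
    hcont
  refine ⟨B, fun z hz Z W hZ hW => ?_⟩
  have hunit : ∀ X : Fin n → ℂ, X ≠ 0 → ‖X‖⁻¹ • X ∈ S := fun X hX => by
    simp [S, norm_smul, hX]
  have hne : ∀ X : Fin n → ℂ, X ≠ 0 → ‖X‖⁻¹ ≠ 0 := fun X hX => by simpa using hX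
  rw [← bisec_smul H z Z W (hne Z hZ) (hne W hW)]
  exact hB ⟨(z, _, _), ⟨hz, hunit Z hZ, hunit W hW⟩, rfl⟩

/-! ### Charts of a complex manifold -/

section charts

variable {M : Type*} [TopologicalSpace M] [ChartedSpace (Fin n → ℂ) M]
  {e e' : OpenPartialHomeomorph M (Fin n → ℂ)} {z : Fin n → ℂ}

theorem contDiffOn_transition [IsManifold 𝓘(ℂ, Fin n → ℂ) ω M] (he : e ∈ atlas (Fin n → ℂ) M)
    (he' : e' ∈ atlas (Fin n → ℂ) M) :
    ContDiffOn ℂ ω (fun x => e' (e.symm x)) (e.symm ≫ₕ e').source := by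
  have h1 : ContMDiffOn 𝓘(ℂ, Fin n → ℂ) 𝓘(ℂ, Fin n → ℂ) ω e' e'.source :=
    contMDiffOn_of_mem_maximalAtlas (IsManifold.subset_maximalAtlas he')
  have h2 : ContMDiffOn 𝓘(ℂ, Fin n → ℂ) 𝓘(ℂ, Fin n → ℂ) ω e.symm e.target :=
    contMDiffOn_symm_of_mem_maximalAtlas (IsManifold.subset_maximalAtlas he)
  have h3 := h1.comp' h2
  rw [contMDiffOn_iff_contDiffOn] at h3
  rwa [OpenPartialHomeomorph.trans_source]

/-- A complex manifold is a real manifold with the same charts. -/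
theorem isManifold_real [IsManifold 𝓘(ℂ, Fin n → ℂ) ω M] (m : ℕ∞ω) :
    IsManifold 𝓘(ℝ, Fin n → ℂ) m M := by
  refine isManifold_of_contDiffOn _ _ _ fun e e' he he' => ?_
  have h := (contDiffOn_transition he he').restrict_scalars ℝ
  have h' := h.of_le (m := m) le_top
  simpa [Function.comp_def] using h'

theorem contDiffAt_comp_symm [IsManifold 𝓘(ℂ, Fin n → ℂ) ω M] (he : e ∈ atlas (Fin n → ℂ) M)
    {m : ℕ∞ω} {u : M → ℝ} (hu : ContMDiff 𝓘(ℝ, Fin n → ℂ) 𝓘(ℝ, ℝ) m u) (hz : z ∈ e.target) :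
    ContDiffAt ℝ m (fun x => u (e.symm x)) z := by
  have : IsManifold 𝓘(ℝ, Fin n → ℂ) m M := isManifold_real m
  have h : ContMDiffAt 𝓘(ℝ, Fin n → ℂ) 𝓘(ℝ, Fin n → ℂ) m e.symm z :=
    contMDiffAt_symm_of_mem_maximalAtlas (IsManifold.subset_maximalAtlas he) hz
  have h2 := (hu (e.symm z)).comp z h
  exact contMDiffAt_iff_contDiffAt.1 h2

/-- The differential of the inverse of a chart, as a linear endomorphism of `ℂⁿ`. -/
def dsymm (e : OpenPartialHomeomorph M (Fin n → ℂ)) (z : Fin n → ℂ) :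
    (Fin n → ℂ) →L[ℂ] (Fin n → ℂ) :=
  mfderiv 𝓘(ℂ, Fin n → ℂ) 𝓘(ℂ, Fin n → ℂ) e.symm z

theorem SesqField.inChart_eq (h : SesqField n M) (z u v : Fin n → ℂ) :
    h.inChart e z u v = (h (e.symm z) : (Fin n → ℂ) →ₗ[ℂ] (Fin n → ℂ) →ₗ⋆[ℂ] ℂ)
      (dsymm e z u) (dsymm e z v) := rfl

theorem SesqField.inChart_smul_left (h : SesqField n M) (c : ℂ) (z u v : Fin n → ℂ) :
    h.inChart e z (c • u) v = c * h.inChart e z u v := by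
  have key : ∀ (B : (Fin n → ℂ) →ₗ[ℂ] (Fin n → ℂ) →ₗ⋆[ℂ] ℂ) (L : (Fin n → ℂ) →L[ℂ] (Fin n → ℂ)),
      B (L (c • u)) (L v) = c * B (L u) (L v) := fun B L => by
    rw [map_smul, map_smul, LinearMap.smul_apply, smul_eq_mul]
  exact key (h (e.symm z)) (dsymm e z)

theorem SesqField.inChart_smul_right (h : SesqField n M) (c : ℂ) (z u v : Fin n → ℂ) :
    h.inChart e z u (c • v) = (starRingEnd ℂ) c * h.inChart e z u v := by
  have key : ∀ (B : (Fin n → ℂ) →ₗ[ℂ] (Fin n → ℂ) →ₗ⋆[ℂ] ℂ) (L : (Fin n → ℂ) →L[ℂ] (Fin n → ℂ)),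
      B (L u) (L (c • v)) = (starRingEnd ℂ) c * B (L u) (L v) := fun B L => by
    rw [map_smul, LinearMap.map_smulₛₗ, smul_eq_mul]
  exact key (h (e.symm z)) (dsymm e z)

theorem sesquilinear_eq_sum (B : (Fin n → ℂ) →ₗ[ℂ] (Fin n → ℂ) →ₗ⋆[ℂ] ℂ)
    (L : (Fin n → ℂ) →L[ℂ] (Fin n → ℂ)) (u v : Fin n → ℂ) :
    B (L u) (L v) = ∑ a, ∑ b, u a * star (v b) * B (L (Pi.single a 1)) (L (Pi.single b 1)) := by
  conv_lhs => rw [pi_eq_sum_univ' u, pi_eq_sum_univ' v]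
  simp only [map_sum, map_smul, LinearMap.sum_apply, LinearMap.smul_apply, smul_eq_mul,
    LinearMap.map_smulₛₗ, Finset.mul_sum]
  rw [Finset.sum_comm]
  exact Finset.sum_congr rfl fun a _ => Finset.sum_congr rfl fun b _ => by
    simp only [Complex.star_def]; ring

theorem SesqField.inChart_eq_sum (h : SesqField n M) (z u v : Fin n → ℂ) :
    h.inChart e z u v = ∑ a, ∑ b, u a * star (v b)
      * h.inChart e z (Pi.single a 1) (Pi.single b 1) :=
  sesquilinear_eq_sum (h (e.symm z)) (dsymm e z) u v

variable [IsManifold 𝓘(ℂ, Fin n → ℂ) ω M]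

theorem dsymm_injective (he : e ∈ atlas (Fin n → ℂ) M) (hz : z ∈ e.target) :
    Function.Injective (dsymm e z) := by
  have : IsManifold 𝓘(ℂ, Fin n → ℂ) 1 M := IsManifold.of_le (n := ω) le_top
  exact (mdifferentiable_of_mem_atlas (I := 𝓘(ℂ, Fin n → ℂ)) he).symm.mfderiv_injective hz

/-- The chain rule for the change of charts `e.symm = e'.symm ∘ (e' ∘ e.symm)`. -/
theorem dsymm_eq_comp (he : e ∈ atlas (Fin n → ℂ) M) (he' : e' ∈ atlas (Fin n → ℂ) M)
    (hz : z ∈ (e.symm ≫ₕ e').source) :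
    dsymm e z = (dsymm e' (e' (e.symm z))).comp (fderiv ℂ (fun x => e' (e.symm x)) z) := by
  have : IsManifold 𝓘(ℂ, Fin n → ℂ) 1 M := IsManifold.of_le (n := ω) le_top
  have hopen := (e.symm ≫ₕ e').open_source
  have hτ := differentiableAt_of_contDiffOn hopen (contDiffOn_transition he he') hz
  have hz2 := hz
  rw [OpenPartialHomeomorph.trans_source] at hz2
  have hm : MDifferentiableAt 𝓘(ℂ, Fin n → ℂ) 𝓘(ℂ, Fin n → ℂ) e'.symm (e' (e.symm z)) :=
    mdifferentiableAt_atlas_symm he' (e'.map_source hz2.2)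
  have heq : (e.symm : (Fin n → ℂ) → M) =ᶠ[𝓝 z] e'.symm ∘ fun x => e' (e.symm x) := by
    filter_upwards [hopen.mem_nhds hz] with x hx
    rw [OpenPartialHomeomorph.trans_source] at hx
    exact (e'.left_inv hx.2).symm
  have h1 := heq.mfderiv_eq (I := 𝓘(ℂ, Fin n → ℂ)) (I' := 𝓘(ℂ, Fin n → ℂ))
  rw [mfderiv_comp z hm hτ.mdifferentiableAt, mfderiv_eq_fderiv] at h1
  exact h1

theorem isUnit_det_jac (he : e ∈ atlas (Fin n → ℂ) M) (he' : e' ∈ atlas (Fin n → ℂ) M)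
    (hz : z ∈ (e.symm ≫ₕ e').source) : IsUnit (jac (fun x => e' (e.symm x)) z).det := by
  have hz2 := hz
  rw [OpenPartialHomeomorph.trans_source] at hz2
  have hinj : Function.Injective (fderiv ℂ (fun x => e' (e.symm x)) z) := by
    have h := dsymm_injective he hz2.1
    rw [dsymm_eq_comp he he' hz] at h
    exact Function.Injective.of_comp h
  rw [← Matrix.isUnit_iff_isUnit_det, ← Matrix.vecMul_injective_iff_isUnit]
  intro u v huv
  apply hinj
  have key : ∀ w : Fin n → ℂ, fderiv ℂ (fun x => e' (e.symm x)) z w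
      = w ᵥ* jac (fun x => e' (e.symm x)) z := by
    intro w
    conv_lhs => rw [pi_eq_sum_univ' w]
    rw [map_sum]
    funext a
    simp [Matrix.vecMul, dotProduct, jac]
  rw [key, key]
  exact huv

theorem SesqField.inChart_change (h : SesqField n M) (he : e ∈ atlas (Fin n → ℂ) M)
    (he' : e' ∈ atlas (Fin n → ℂ) M) (hz : z ∈ (e.symm ≫ₕ e').source) (u v : Fin n → ℂ) :
    h.inChart e z u v = h.inChart e' (e' (e.symm z))
      (fderiv ℂ (fun x => e' (e.symm x)) z u) (fderiv ℂ (fun x => e' (e.symm x)) z v) := by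
  have hz2 := hz
  rw [OpenPartialHomeomorph.trans_source] at hz2
  have hp : ∀ (p q : M) (a b : Fin n → ℂ), p = q →
      (h p : (Fin n → ℂ) →ₗ[ℂ] (Fin n → ℂ) →ₗ⋆[ℂ] ℂ) a b
        = (h q : (Fin n → ℂ) →ₗ[ℂ] (Fin n → ℂ) →ₗ⋆[ℂ] ℂ) a b := by
    rintro p q a b rfl; rfl
  rw [SesqField.inChart_eq, SesqField.inChart_eq, dsymm_eq_comp he he' hz,
    hp _ _ _ _ (e'.left_inv hz2.2)]
  rfl

end charts

namespace KahlerMetric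

variable {M : Type*} [TopologicalSpace M] [ChartedSpace (Fin n → ℂ) M]
  {e e' : OpenPartialHomeomorph M (Fin n → ℂ)} {z : Fin n → ℂ}

/-- The components of a closed Hermitian form satisfy `∂ₖ g_{ij̄} = ∂ᵢ g_{kj̄}`: this is the
vanishing of the component of type `(2, 1)` of `dω`. -/
theorem wirt_coeff_symm (g : KahlerMetric n M) (he : e ∈ atlas (Fin n → ℂ) M) (hz : z ∈ e.target)
    (i j k : Fin n) :
    wirt (-1) k (fun x => g.coeff e x i j) z = wirt (-1) i (fun x => g.coeff e x k j) z := by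
  set b : Fin n → Fin n → ℂ := fun a => Pi.single a 1 with hb
  set c : Fin n → Fin n → ℂ := fun a => Pi.single a I with hc
  have hcb : ∀ a, c a = I • b a := fun a => single_I a
  set P : (Fin n → ℂ) → (Fin n → ℂ) → (Fin n → ℂ) → ℂ := fun u v x => g.toForm.inChart e x u v
    with hP
  have hd : ∀ u v, DifferentiableAt ℝ (P u v) z := fun u v =>
    ((g.smooth e he u v).contDiffAt (e.open_target.mem_nhds hz)).differentiableAt (by simp)
  have hform : ∀ u v w, fderiv ℝ (fun x => g.toForm.form e x v w) z u
      = -2 * (fderiv ℝ (P v w) z u).im := fun u v w => by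
    have h := ((imCLM.hasFDerivAt.comp z (hd v w).hasFDerivAt).const_mul (-2 : ℝ)).fderiv
    have h2 : fderiv ℝ (fun x => g.toForm.form e x v w) z
        = (-2 : ℝ) • (imCLM.comp (fderiv ℝ (P v w) z)) := h
    rw [h2]
    simp
  have hclosed : ∀ u v w, (fderiv ℝ (P v w) z u).im + (fderiv ℝ (P w u) z v).im
      + (fderiv ℝ (P u v) z w).im = 0 := fun u v w => by
    have h := g.closed e he z hz u v w
    rw [hform, hform, hform] at h
    linarith
  have hIl : ∀ u v w, fderiv ℝ (P (I • u) v) z w = I * fderiv ℝ (P u v) z w := fun u v w => by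
    have h : P (I • u) v = fun x => I * P u v x := by
      funext x
      exact SesqField.inChart_smul_left _ _ _ _ _
    rw [h, fderiv_const_mul (hd u v)]
    simp
  have hIr : ∀ u v w, fderiv ℝ (P u (I • v)) z w = -I * fderiv ℝ (P u v) z w := fun u v w => by
    have h : P u (I • v) = fun x => -I * P u v x := by
      funext x
      rw [← conj_I]
      exact SesqField.inChart_smul_right _ _ _ _ _
    rw [h, fderiv_const_mul (hd u v)]
    simp
  have hconj : ∀ u v w, (fderiv ℝ (P v u) z w) = (starRingEnd ℂ) (fderiv ℝ (P u v) z w) :=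
    fun u v w => by
    have h : P v u = fun x => conjCLE (P u v x) := by
      funext x
      exact g.hermitian _ _ _
    have h2 : fderiv ℝ (fun x => conjCLE (P u v x)) z
        = (conjCLE : ℂ →L[ℝ] ℂ).comp (fderiv ℝ (P u v) z) := conjCLE.comp_fderiv (f := P u v)
    rw [h, h2]
    simp
  -- the closedness relation, evaluated on the eight triples of real coordinate vectors
  have c1 := hclosed (b k) (b i) (b j)
  have c2 := hclosed (c k) (b i) (b j)
  have c3 := hclosed (b k) (c i) (b j)
  have c4 := hclosed (b k) (b i) (c j)
  have c5 := hclosed (c k) (c i) (b j)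
  have c6 := hclosed (c k) (b i) (c j)
  have c7 := hclosed (b k) (c i) (c j)
  have c8 := hclosed (c k) (c i) (c j)
  have hji : ∀ w, fderiv ℝ (P (b j) (b k)) z w = (starRingEnd ℂ) (fderiv ℝ (P (b k) (b j)) z w) :=
    fun w => hconj _ _ _
  simp only [hcb, hIl, hIr, hji] at c1 c2 c3 c4 c5 c6 c7 c8
  have goal' : fderiv ℝ (P (b i) (b j)) z (b k) - I * fderiv ℝ (P (b i) (b j)) z (c k)
      = fderiv ℝ (P (b k) (b j)) z (b i) - I * fderiv ℝ (P (b k) (b j)) z (c i) := by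
    simp only [hcb]
    apply Complex.ext
    · simp at c1 c2 c3 c4 c5 c6 c7 c8 ⊢
      linarith
    · simp at c1 c2 c3 c4 c5 c6 c7 c8 ⊢
      linarith
  have e1 : (fun x => g.coeff e x i j) = P (b i) (b j) := rfl
  have e2 : (fun x => g.coeff e x k j) = P (b k) (b j) := rfl
  rw [e1, e2]
  simp only [wirt]
  linear_combination (1 / 2 : ℂ) * goal'

theorem matContDiffAt_coeff (g : KahlerMetric n M) (he : e ∈ atlas (Fin n → ℂ) M)
    (hz : z ∈ e.target) : MatContDiffAt ∞ (g.coeff e) z := fun i j =>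
  (g.smooth e he (Pi.single i 1) (Pi.single j 1)).contDiffAt (e.open_target.mem_nhds hz)

theorem bisectional_eq_bisec (g : KahlerMetric n M) (p : M) (Z W : Fin n → ℂ) :
    g.bisectional p Z W
      = bisec (g.coeff (chartAt (Fin n → ℂ) p)) (chartAt (Fin n → ℂ) p p) Z W := by
  have hc : ∀ i j k l, g.curvature p i j k l
      = matCurv (g.coeff (chartAt (Fin n → ℂ) p)) k l (chartAt (Fin n → ℂ) p p) i j := by
    intro i j k l
    simp only [curvature, matCurv, Matrix.sub_apply, Matrix.mul_apply, dz_eq_wirt, dzbar_eq_wirt,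
      Finset.sum_mul]
    congr 1
    refine Finset.sum_congr rfl fun s _ => Finset.sum_congr rfl fun r _ => ?_
    simp only [wirtM, Matrix.of_apply]
    ring
  simp only [bisectional, bisec, curvForm, sesq, normSq, hc]
  rfl

variable [IsManifold 𝓘(ℂ, Fin n → ℂ) ω M]

theorem coeff_change (g : KahlerMetric n M) (he : e ∈ atlas (Fin n → ℂ) M)
    (he' : e' ∈ atlas (Fin n → ℂ) M) (hz : z ∈ (e.symm ≫ₕ e').source) :
    g.coeff e z = jac (fun x => e' (e.symm x)) z * g.coeff e' (e' (e.symm z))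
      * (jac (fun x => e' (e.symm x)) z)ᴴ := by
  ext j k
  have h : g.coeff e z j k = g.toForm.inChart e z (Pi.single j 1) (Pi.single k 1) := rfl
  rw [h, SesqField.inChart_change _ he he' hz, SesqField.inChart_eq_sum, Finset.sum_comm]
  simp only [Matrix.mul_apply, Finset.sum_mul]
  refine Finset.sum_congr rfl fun b _ => Finset.sum_congr rfl fun a _ => ?_
  simp only [jac, coeff, Matrix.of_apply, Matrix.conjTranspose_apply]
  ring

theorem coeff_posDef (g : KahlerMetric n M) (he : e ∈ atlas (Fin n → ℂ) M) (hz : z ∈ e.target) :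
    (g.coeff e z).PosDef := by
  have hherm : ∀ u v, g.toForm.inChart e z v u = (starRingEnd ℂ) (g.toForm.inChart e z u v) :=
    fun u v => g.hermitian _ _ _
  refine Matrix.PosDef.of_dotProduct_mulVec_pos ?_ fun x hx => ?_
  · ext j k
    exact (hherm (Pi.single k 1) (Pi.single j 1)).symm
  · have h : star x ⬝ᵥ (g.coeff e z *ᵥ x) = g.toForm.inChart e z (star x) (star x) := by
      rw [SesqField.inChart_eq_sum]
      simp only [dotProduct, Matrix.mulVec, Finset.mul_sum, Pi.star_apply, star_star]
      exact Finset.sum_congr rfl fun a _ => Finset.sum_congr rfl fun b _ => by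
        simp only [coeff, Matrix.of_apply]; ring
    rw [h]
    have hx' : dsymm e z (star x) ≠ 0 := fun h0 => by
      have := dsymm_injective he hz (h0.trans (map_zero _).symm)
      exact hx (by simpa using this)
    have hpos : 0 < (g.toForm.inChart e z (star x) (star x)).re := g.pos _ _ hx'
    have him := congrArg Complex.im (hherm (star x) (star x))
    rw [conj_im] at him
    rw [Complex.lt_def]
    refine ⟨hpos, ?_⟩
    simp only [zero_im]
    linarith

theorem isKahlerOn_coeff (g : KahlerMetric n M) (he : e ∈ atlas (Fin n → ℂ) M) :
    IsKahlerOn e.target (g.coeff e) where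
  contDiffAt z hz i j :=
    ((g.smooth e he (Pi.single i 1) (Pi.single j 1)).contDiffAt (e.open_target.mem_nhds hz)).of_le
      (by norm_cast)
  posDef z hz := g.coeff_posDef he hz
  closed z hz i j k := g.wirt_coeff_symm he hz i j k

/-- On a compact manifold the bisectional curvature is bounded, so that `bisectionalSup` is a
genuine supremum. The preferred chart may jump from point to point; the bound is therefore proved in
one fixed chart near each point, and transferred by the invariance of the curvature. -/
theorem bddAbove_bisectional [CompactSpace M] (g : KahlerMetric n M) :
    BddAbove {r : ℝ | ∃ (p : M) (Z W : Fin n → ℂ), Z ≠ 0 ∧ W ≠ 0 ∧ r = |g.bisectional p Z W|} := by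
  suffices h : ∃ B : ℝ, ∀ p ∈ (Set.univ : Set M), ∀ Z W : Fin n → ℂ, Z ≠ 0 → W ≠ 0 →
      |g.bisectional p Z W| ≤ B by
    obtain ⟨B, hB⟩ := h
    refine ⟨B, ?_⟩
    rintro r ⟨p, Z, W, hZ, hW, rfl⟩
    exact hB p trivial Z W hZ hW
  refine isCompact_univ.induction_on (p := fun S : Set M => ∃ B : ℝ, ∀ p ∈ S,
    ∀ Z W : Fin n → ℂ, Z ≠ 0 → W ≠ 0 → |g.bisectional p Z W| ≤ B) ⟨0, by simp⟩ ?_ ?_ ?_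
  · rintro S T hST ⟨B, hB⟩
    exact ⟨B, fun p hp => hB p (hST hp)⟩
  · rintro S T ⟨B, hB⟩ ⟨B', hB'⟩
    refine ⟨max B B', fun p hp Z W hZ hW => ?_⟩
    rcases hp with hp | hp
    · exact (hB p hp Z W hZ hW).trans (le_max_left _ _)
    · exact (hB' p hp Z W hZ hW).trans (le_max_right _ _)
  · intro p₀ _
    set e₀ := chartAt (Fin n → ℂ) p₀ with he₀def
    have he₀ : e₀ ∈ atlas (Fin n → ℂ) M := chart_mem_atlas _ _
    have hp₀ : p₀ ∈ e₀.source := mem_chart_source _ _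
    obtain ⟨C, hC, hCp, hCt⟩ :=
      exists_compact_subset e₀.open_target (e₀.map_source hp₀)
    obtain ⟨B, hB⟩ := (g.isKahlerOn_coeff he₀).exists_bisec_le hC hCt
    refine ⟨e₀.source ∩ e₀ ⁻¹' C, ?_, B, ?_⟩
    · refine mem_nhdsWithin_of_mem_nhds (Filter.inter_mem (e₀.open_source.mem_nhds hp₀) ?_)
      exact e₀.continuousAt hp₀ (mem_interior_iff_mem_nhds.1 hCp)
    · rintro p ⟨hp, hpC⟩ Z W hZ hW
      set e := chartAt (Fin n → ℂ) p
      have he : e ∈ atlas (Fin n → ℂ) M := chart_mem_atlas _ _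
      have hpe : p ∈ e.source := mem_chart_source _ _
      have hinv : e.symm (e p) = p := e.left_inv hpe
      have hz : e p ∈ (e.symm ≫ₕ e₀).source :=
        ⟨e.map_source hpe, (congrArg (· ∈ e₀.source) hinv).mpr hp⟩
      have hmem : ∀ x ∈ (e.symm ≫ₕ e₀).source, e₀ (e.symm x) ∈ e₀.target := fun x hx => by
        rw [OpenPartialHomeomorph.trans_source] at hx
        exact e₀.map_source hx.2
      have hJ := isUnit_det_jac he he₀ hz
      have hinj := Matrix.vecMul_injective_iff_isUnit.2 ((Matrix.isUnit_iff_isUnit_det _).2 hJ)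
      have hne : ∀ X : Fin n → ℂ, X ≠ 0 → X ᵥ* jac (fun x => e₀ (e.symm x)) (e p) ≠ 0 :=
        fun X hX h0 => hX (hinj (by simpa using h0))
      rw [bisectional_eq_bisec, bisec_change (e.symm ≫ₕ e₀).open_source
        (contDiffOn_transition he he₀) hz (P := g.coeff e₀)
        (fun x hx => (g.isKahlerOn_coeff he₀).contDiffAt _ (hmem x hx))
        ((g.isKahlerOn_coeff he₀).isUnit_det (hmem _ hz)) hJ
        (fun x hx => g.coeff_change he he₀ hx)]
      exact hB _ (by rw [hinv]; exact hpC) _ _ (hne Z hZ) (hne W hW)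

end KahlerMetric

/-! ### The deformed metric and the Laplacians in an arbitrary chart -/

theorem hessian_congr_of_eqOn {U : Set (Fin n → ℂ)} (hU : IsOpen U) {u v : (Fin n → ℂ) → ℂ}
    (h : Set.EqOn u v U) {z : Fin n → ℂ} (hz : z ∈ U) : hessian u z = hessian v z := by
  ext j k
  exact wirt_congr_of_eqOn hU hz fun x hx => wirt_congr_of_eqOn hU hx h

theorem trace_inv_mul_congr {J A : Matrix (Fin n) (Fin n) ℂ} (hJ : IsUnit J.det)
    (B : Matrix (Fin n) (Fin n) ℂ) :
    ((J * A * Jᴴ)⁻¹ * (J * B * Jᴴ)).trace = (A⁻¹ * B).trace := by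
  have hJ' : IsUnit (Jᴴ).det := by rw [Matrix.det_conjTranspose]; exact hJ.star
  have h : (J * A * Jᴴ)⁻¹ * (J * B * Jᴴ) = (Jᴴ)⁻¹ * (A⁻¹ * B * Jᴴ) := by
    rw [Matrix.mul_inv_rev, Matrix.mul_inv_rev]
    have a : ∀ X, J⁻¹ * (J * X) = X := fun X => by
      rw [← Matrix.mul_assoc, Matrix.nonsing_inv_mul _ hJ, Matrix.one_mul]
    simp only [Matrix.mul_assoc, a]
  rw [h, Matrix.trace_mul_comm, Matrix.mul_assoc, Matrix.mul_nonsing_inv _ hJ', Matrix.mul_one]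

section

variable {M : Type*} [TopologicalSpace M] [ChartedSpace (Fin n → ℂ) M]
  {e e' : OpenPartialHomeomorph M (Fin n → ℂ)} {z : Fin n → ℂ}

theorem complexHessian_eq_hessian (u : M → ℝ) (p : M) :
    complexHessian u p = hessian (fun x => (u ((chartAt (Fin n → ℂ) p).symm x) : ℂ))
      (chartAt (Fin n → ℂ) p p) := by
  rw [complexHessian, dz_eq_wirt, dzbar_eq_wirt]
  rfl

theorem complexLaplacian_eq_trace (G : M → Matrix (Fin n) (Fin n) ℂ) (u : M → ℝ) (p : M) :
    complexLaplacian G u p = -((G p)⁻¹ * complexHessian u p).trace.re := by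
  rw [complexLaplacian, complexHessian_eq_hessian, trace_mul_hessian]
  rfl

theorem hessian_change [IsManifold 𝓘(ℂ, Fin n → ℂ) ω M] {u : M → ℝ}
    (hu : ContMDiff 𝓘(ℝ, Fin n → ℂ) 𝓘(ℝ, ℝ) 2 u) (he : e ∈ atlas (Fin n → ℂ) M)
    (he' : e' ∈ atlas (Fin n → ℂ) M) (hz : z ∈ (e.symm ≫ₕ e').source) :
    hessian (fun x => (u (e.symm x) : ℂ)) z = jac (fun x => e' (e.symm x)) z
      * hessian (fun x => (u (e'.symm x) : ℂ)) (e' (e.symm z))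
      * (jac (fun x => e' (e.symm x)) z)ᴴ := by
  have hmem : ∀ x ∈ (e.symm ≫ₕ e').source, e.symm x ∈ e'.source := fun x hx => hx.2
  rw [← hessian_comp (e.symm ≫ₕ e').open_source (contDiffOn_transition he he') hz
    (v := fun x => (u (e'.symm x) : ℂ))
    fun x hx => (contDiffAt_comp_symm he' hu (e'.map_source (hmem x hx))).ofReal_comp]
  exact hessian_congr_of_eqOn (e.symm ≫ₕ e').open_source
    (fun x hx => by simp only [e'.left_inv (hmem x hx)]) hz

theorem self_mem_trans_chartAt (hz : z ∈ e.target) :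
    z ∈ (e.symm ≫ₕ chartAt (Fin n → ℂ) (e.symm z)).source :=
  ⟨hz, mem_chart_source _ _⟩

end

namespace KahlerMetric

variable {M : Type*} [TopologicalSpace M] [ChartedSpace (Fin n → ℂ) M]
  {e e' : OpenPartialHomeomorph M (Fin n → ℂ)} {z : Fin n → ℂ}

/-- The components of `g + ∂∂̄φ` in the chart `e`. -/
def deformed (g : KahlerMetric n M) (φ : M → ℝ) (e : OpenPartialHomeomorph M (Fin n → ℂ))
    (z : Fin n → ℂ) : Matrix (Fin n) (Fin n) ℂ :=
  g.coeff e z + hessian (fun x => (φ (e.symm x) : ℂ)) z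

theorem deformedAt_eq_deformed (g : KahlerMetric n M) (φ : M → ℝ) (p : M) :
    g.deformedAt φ p = g.deformed φ (chartAt (Fin n → ℂ) p) (chartAt (Fin n → ℂ) p p) := by
  rw [deformedAt, complexHessian_eq_hessian]
  rfl

theorem matContDiffAt_deformed (g : KahlerMetric n M) {φ : M → ℝ} (he : e ∈ atlas (Fin n → ℂ) M)
    (hz : z ∈ e.target) (hφ : ContDiffAt ℝ 4 (fun x => φ (e.symm x)) z) :
    MatContDiffAt 2 (g.deformed φ e) z :=
  ((g.matContDiffAt_coeff he hz).of_le (by norm_cast)).add fun _ _ =>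
    (hφ.ofReal_comp.wirt (m := 3) (by norm_num)).wirt (by norm_num)

variable [IsManifold 𝓘(ℂ, Fin n → ℂ) ω M]

theorem deformed_change (g : KahlerMetric n M) {φ : M → ℝ}
    (hφ : ContMDiff 𝓘(ℝ, Fin n → ℂ) 𝓘(ℝ, ℝ) 2 φ) (he : e ∈ atlas (Fin n → ℂ) M)
    (he' : e' ∈ atlas (Fin n → ℂ) M) (hz : z ∈ (e.symm ≫ₕ e').source) :
    g.deformed φ e z = jac (fun x => e' (e.symm x)) z * g.deformed φ e' (e' (e.symm z))
      * (jac (fun x => e' (e.symm x)) z)ᴴ := by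
  rw [deformed, deformed, g.coeff_change he he' hz, hessian_change hφ he he' hz, Matrix.mul_add,
    Matrix.add_mul]

/-- Positivity is assumed in the preferred charts only, and carried to the chart `e` by the
transformation rule; closedness holds because derivatives commute. -/
theorem isKahlerOn_deformed (g : KahlerMetric n M) {φ : M → ℝ}
    (hφ : ContMDiff 𝓘(ℝ, Fin n → ℂ) 𝓘(ℝ, ℝ) 4 φ) (hadm : g.Admissible φ)
    (he : e ∈ atlas (Fin n → ℂ) M) : IsKahlerOn e.target (g.deformed φ e) where
  contDiffAt z hz := g.matContDiffAt_deformed he hz (contDiffAt_comp_symm he hφ hz)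
  posDef z hz := by
    have he' := chart_mem_atlas (Fin n → ℂ) (e.symm z)
    have hz' := self_mem_trans_chartAt hz
    rw [g.deformed_change (hφ.of_le (by norm_num)) he he' hz', ← deformedAt_eq_deformed]
    exact (hadm _).congr_of_isUnit ((Matrix.isUnit_iff_isUnit_det _).2 (isUnit_det_jac he he' hz'))
  closed z hz i j k := by
    have hΦ := (contDiffAt_comp_symm he hφ hz).ofReal_comp
    have hj : ContDiffAt ℝ 3 (wirt 1 j fun x => (φ (e.symm x) : ℂ)) z := hΦ.wirt (by norm_num)
    have hij : ∀ i, DifferentiableAt ℝ (wirt (-1) i (wirt 1 j fun x => (φ (e.symm x) : ℂ))) z :=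
      fun i => (hj.wirt (m := 2) (by norm_num)).differentiableAt (by norm_num)
    have hg := fun i => (g.matContDiffAt_coeff he hz).differentiableAt
      (by norm_cast) i j
    have hG := g.wirt_coeff_symm he hz i j k
    have hc := wirt_comm (s := -1) (t := -1) (j := k) (k := i) (hj.of_le (m := 2) (by norm_num))
    have e1 := wirt_add (s := -1) (j := k) (hg i) (hij i)
    have e2 := wirt_add (s := -1) (j := i) (hg k) (hij k)
    rw [hG, hc, ← e2] at e1
    exact e1

theorem det_deformed (g : KahlerMetric n M) {φ f : M → ℝ}
    (hφ : ContMDiff 𝓘(ℝ, Fin n → ℂ) 𝓘(ℝ, ℝ) 2 φ) (hYC : ∀ p, g.YC φ p = (Real.exp (f p) : ℂ))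
    (he : e ∈ atlas (Fin n → ℂ) M) (hz : z ∈ e.target) :
    (g.deformed φ e z).det = exp (f (e.symm z)) * (g.coeff e z).det := by
  have he' := chart_mem_atlas (Fin n → ℂ) (e.symm z)
  have hz' := self_mem_trans_chartAt hz
  have h := hYC (e.symm z)
  have hne : (g.coeffAt (e.symm z)).det ≠ 0 :=
    ((g.isKahlerOn_coeff he').isUnit_det (mem_chart_target _ _)).ne_zero
  rw [YC, div_eq_iff hne, deformedAt_eq_deformed, coeffAt, ofReal_exp] at h
  rw [g.deformed_change hφ he he' hz', g.coeff_change he he' hz']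
  simp only [Matrix.det_mul, h]
  ring

theorem laplacian_eq_trace (g : KahlerMetric n M) {u : M → ℝ}
    (hu : ContMDiff 𝓘(ℝ, Fin n → ℂ) 𝓘(ℝ, ℝ) 2 u) (he : e ∈ atlas (Fin n → ℂ) M)
    (hz : z ∈ e.target) :
    g.laplacian u (e.symm z)
      = -((g.coeff e z)⁻¹ * hessian (fun x => (u (e.symm x) : ℂ)) z).trace.re := by
  have he' := chart_mem_atlas (Fin n → ℂ) (e.symm z)
  have hz' := self_mem_trans_chartAt hz
  rw [laplacian, complexLaplacian_eq_trace, complexHessian_eq_hessian, g.coeff_change he he' hz',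
    hessian_change hu he he' hz', trace_inv_mul_congr (isUnit_det_jac he he' hz')]
  rfl

theorem sub_laplacian_eq_trace (g : KahlerMetric n M) {φ : M → ℝ}
    (hφ : ContMDiff 𝓘(ℝ, Fin n → ℂ) 𝓘(ℝ, ℝ) 2 φ) (he : e ∈ atlas (Fin n → ℂ) M)
    (hz : z ∈ e.target) :
    (n : ℝ) - g.laplacian φ (e.symm z) = ((g.coeff e z)⁻¹ * g.deformed φ e z).trace.re := by
  rw [g.laplacian_eq_trace hφ he hz, deformed, mul_add,
    Matrix.nonsing_inv_mul _ ((g.isKahlerOn_coeff he).isUnit_det hz), Matrix.trace_add,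
    Matrix.trace_one, Fintype.card_fin, add_re, natCast_re, sub_neg_eq_add]

/-- A bound for the bisectional curvature, cleared of denominators. -/
theorem abs_curvForm_le [CompactSpace M] (g : KahlerMetric n M) {K : ℝ} (hK : g.bisectionalSup ≤ K)
    (p : M) {Z W : Fin n → ℂ} (hZ : Z ≠ 0) (hW : W ≠ 0) :
    |(curvForm (g.coeff (chartAt (Fin n → ℂ) p)) (chartAt (Fin n → ℂ) p p) Z W).re|
      ≤ K * ((sesq (g.coeffAt p) Z).re * (sesq (g.coeffAt p) W).re) := by
  have h1 : |g.bisectional p Z W| ≤ K :=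
    (le_csSup g.bddAbove_bisectional ⟨p, Z, W, hZ, hW, rfl⟩).trans hK
  have hpd : (g.coeffAt p).PosDef :=
    g.coeff_posDef (chart_mem_atlas (Fin n → ℂ) p) (mem_chart_target _ _)
  have hpos : 0 < (sesq (g.coeffAt p) Z).re * (sesq (g.coeffAt p) W).re :=
    mul_pos (sesq_re_pos hpd hZ) (sesq_re_pos hpd hW)
  rw [bisectional_eq_bisec, bisec, abs_div] at h1
  change _ / |(sesq (g.coeffAt p) Z).re * (sesq (g.coeffAt p) W).re| ≤ K at h1
  rwa [abs_of_pos hpos, div_le_iff₀ hpos] at h1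

end KahlerMetric

theorem IsKahlerOn.trace_inv_mul_pos (hn : 0 < n) {U : Set (Fin n → ℂ)}
    {G H : (Fin n → ℂ) → Matrix (Fin n) (Fin n) ℂ} (hG : IsKahlerOn U G) (hH : IsKahlerOn U H)
    {x : Fin n → ℂ} (hx : x ∈ U) :
    0 < ((G x)⁻¹ * H x).trace.re ∧
      ((((G x)⁻¹ * H x).trace.re : ℝ) : ℂ) = ((G x)⁻¹ * H x).trace := by
  obtain ⟨Q, lam, hlam, hQ, hQG, hQH⟩ :=
    exists_simultaneous_diagonalization (hG.posDef x hx) (hH.posDef x hx)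
  have : Nonempty (Fin n) := ⟨⟨0, hn⟩⟩
  rw [(trace_inv_mul_eq_sum hlam hQ hQG hQH).1, ofReal_re]
  exact ⟨Finset.sum_pos (fun i _ => hlam i) Finset.univ_nonempty, rfl⟩

end

theorem mainTheorem8 (K : ℝ) :
    ∃ c : ℝ, 0 < c ∧
      ∀ n : ℕ, 2 ≤ n → ∀ F₀ F₁ : ℝ,
        ∃ A B C : ℝ, 0 < C ∧
          ∀ (M : Type*) [TopologicalSpace M] [T2Space M] [CompactSpace M]
            [ChartedSpace (Fin n → ℂ) M] [IsManifold 𝓘(ℂ, Fin n → ℂ) ω M]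
            (g : KahlerMetric n M), g.bisectionalSup ≤ K →
          ∀ φ f : M → ℝ,
            ContMDiff 𝓘(ℝ, Fin n → ℂ) 𝓘(ℝ, ℝ) 5 φ →
            ContMDiff 𝓘(ℝ, Fin n → ℂ) 𝓘(ℝ, ℝ) 3 f →
            g.Admissible φ →
            (∀ p, g.YC φ p = (Real.exp (f p) : ℂ)) →
            (∀ p, f p ≤ F₀) →
            (∀ p, g.laplacian f p ≤ F₁) →
            ∀ p : M,
              ((n : ℝ) - g.laplacian φ p) *
                  g.deformedLaplacian φ
                    (fun q => Real.log ((n : ℝ) - g.laplacian φ q) - c * φ q) p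
                ≤ A + B * ((n : ℝ) - g.laplacian φ p)
                  - C * ((n : ℝ) - g.laplacian φ p) ^ ((n : ℝ) / ((n : ℝ) - 1)) := by
  refine ⟨|K| + 1, by positivity, fun n hn F₀ F₁ => ⟨F₁ + |K| * (n : ℝ) ^ 2, (|K| + 1) * n,
    Real.exp (-F₀ / ((n : ℝ) - 1)), Real.exp_pos _, ?_⟩⟩
  intro M _ _ _ _ _ g hK φ f hφ hf hadm hYC hF₀ hF₁ p
  have he : chartAt (Fin n → ℂ) p ∈ atlas (Fin n → ℂ) M := chart_mem_atlas _ _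
  have hz : chartAt (Fin n → ℂ) p p ∈ (chartAt (Fin n → ℂ) p).target := mem_chart_target _ _
  have hp : (chartAt (Fin n → ℂ) p).symm (chartAt (Fin n → ℂ) p p) = p :=
    (chartAt (Fin n → ℂ) p).left_inv (mem_chart_source _ _)
  have hφ2 : ContMDiff 𝓘(ℝ, Fin n → ℂ) 𝓘(ℝ, ℝ) 2 φ := hφ.of_le (by norm_num)
  have hf2 : ContMDiff 𝓘(ℝ, Fin n → ℂ) 𝓘(ℝ, ℝ) 2 f := hf.of_le (by norm_num)
  have hG := g.isKahlerOn_coeff he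
  have hH := g.isKahlerOn_deformed (hφ.of_le (by norm_num)) hadm he
  have hcurv := fun Z W hZ hW => g.abs_curvForm_le hK p (Z := Z) (W := W) hZ hW
  have hlap := fun x hx => g.sub_laplacian_eq_trace hφ2 he (z := x) hx
  have hlapp := hlap _ hz
  have hlapf := hF₁ p
  rw [hp] at hlapp
  rw [← hp, g.laplacian_eq_trace hf2 he hz] at hlapf
  rw [KahlerMetric.deformedLaplacian, complexLaplacian_eq_trace, g.deformedAt_eq_deformed,
    complexHessian_eq_hessian, hlapp]
  -- `tr (G⁻¹ H)` is real and positive, so its logarithm is smooth on the whole chart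
  have htr := fun x hx => hG.trace_inv_mul_pos (by omega) hH (x := x) hx
  have hlog : ∀ x ∈ (chartAt (Fin n → ℂ) p).target, ContDiffAt ℝ 2
      (fun x => Real.log ((g.coeff (chartAt (Fin n → ℂ) p) x)⁻¹
        * g.deformed φ (chartAt (Fin n → ℂ) p) x).trace.re) x :=
    fun x hx => ContDiffAt.log (Complex.reCLM.contDiff.contDiffAt.comp x
      (((hG.contDiffAt x hx).inv (hG.isUnit_det hx)).mul (hH.contDiffAt x hx)).trace)
      (htr x hx).1.ne'
  have hmain := laplacian_log_trace_le hn (chartAt (Fin n → ℂ) p).open_target hG hH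
    (f := fun x => f ((chartAt (Fin n → ℂ) p).symm x))
    (Φ := fun x => φ ((chartAt (Fin n → ℂ) p).symm x))
    (fun x hx => contDiffAt_comp_symm he hf2 hx) (fun x hx => contDiffAt_comp_symm he hφ2 hx) hlog
    (fun x hx => g.det_deformed hφ2 hYC he hx)
    (fun x hx => by rw [← Complex.ofReal_exp, Real.exp_log (htr x hx).1, (htr x hx).2])
    hz rfl (hF₀ _) hlapf hcurv
  rw [hessian_congr_of_eqOn (chartAt (Fin n → ℂ) p).open_target (fun x hx => ?_) hz]
  · exact hmain
  · simp only [hlap x hx]
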